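/- **Setting.** Let $\mathbb{T}^+$ be $\mathbb{N}\cup\{0\}$ or $[0,\infty)$, let $(\Omega,\mathcal{F},(\mathcal{F}_t)_{t\in\mathbb{T}^+},\mathbb{P})$ be a filtered probability space, and put $\mathcal{F}_+:=\sigma(\mathcal{F}_t:t\in\mathbb{T}^+)$. Let $(\theta^t)_{t\in\mathbb{T}^+}$ be $\mathbb{P}$-preserving measurable automorphisms of $(\Omega,\mathcal{F})$ with $\theta^0=\mathrm{id}$ and $\theta^{s+t}=\theta^t\circ\theta^s$, such that for all $s,t$: $\theta^{-t}\mathcal{F}_s\subset\mathcal{F}_{s+t}$, and $\mathcal{F}_t$ and $\theta^{-t}\mathcal{F}_+$ are independent. Assume that $\mathbb{P}$ is ergodic for $(\theta^t)$, i.e. if $E\in\mathcal{F}$ and $\mathbb{P}(\theta^{-t}(E)\,\triangle\,E)=0$ for all $t$, then $\mathbb{P}(E)\in\{0,1\}$. Put $\mathcal{F}_-:=\sigma(\theta^t\mathcal{F}_t:t\in\mathbb{T}^+)$. Let $\mathbb{S}^1=\mathbb{R}/\mathbb{Z}$, with its usual metric $d$ and normalised Lebesgue measure $l$. Let $\varphi$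 be a random dynamical system on $\mathbb{S}^1$, i.e. a family of orientation-preserving homeomorphisms $\varphi(t,\omega):\mathbb{S}^1\to\mathbb{S}^1$ ($t\in\mathbb{T}^+$, $\omega\in\Omega$) such that * $(\omega,x)\mapsto\varphi(t,\omega)x$ is $\mathcal{F}_t\otimes\mathcal{B}(\mathbb{S}^1)$-measurable for each $t$; * $\varphi(0,\omega)=\mathrm{id}$ and $\varphi(s+t,\omega)=\varphi(t,\theta^s\omega)\circ\varphi(s,\omega)$ for all $s,t,\omega$; * if $t_n$ decreases to $t$ and $x_n\to x$, then $\varphi(t_n,\omega)x_n\to\varphi(t,\omega)x$ for all $\omega$; * there is a function $\varphi_-:\mathbb{T}^+\times\Omega\times\mathbb{S}^1\to\mathbb{S}^1$ such that, if $t_n$ increases strictly to $t$ and $x_n\to x$, then $\varphi(t_n,\omega)x_n\to\varphi_-(t,\omega,x)$ for all $\omega$. **Definitions.** $\varphi$ is *stably synchronising* if for all $x,y\in\mathbb{S}^1$, almost surely $d(\varphi(t,\omega)x,\varphi(t,\omega)y)\to0$ as $t\to\infty$, and for all $x\in\mathbb{S}^1$, almost surely there is an open $U\ni x$ with $l(\varphi(t,\omega)U)\to0$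 as $t\to\infty$. A *crack point* of $\omega$ is a point $p\in\mathbb{S}^1$ such that $l(\varphi(t,\omega)G)\to0$ as $t\to\infty$ for every closed $G\subset\mathbb{S}^1$ with $p\notin G$. A *random fixed point* is an $\mathcal{F}$-measurable function $q:\Omega\to\mathbb{S}^1$ such that for each $t$, almost surely $\varphi(t,\omega)q(\omega)=q(\theta^t\omega)$; write $\boldsymbol{\delta}_q(A)=\mathbb{P}(\omega:(\omega,q(\omega))\in A)$ for $A\in\mathcal{F}\otimes\mathcal{B}(\mathbb{S}^1)$. An *invariant measure* of $\varphi$ is a probability measure on $(\Omega\times\mathbb{S}^1,\mathcal{F}\otimes\mathcal{B}(\mathbb{S}^1))$ with marginal $\mathbb{P}$ on $\Omega$ that is invariant under $(\omega,x)\mapsto(\theta^t\omega,\varphi(t,\omega)x)$ for every $t\in\mathbb{T}^+$. **Theorem 5.13.** If $\varphi$ is stably synchronising, then $\varphi$ is *simple*. That is, almost every $\omega$ admits a crack point, and there are an $\mathcal{F}_+$-measurable random fixed point $r$ and an $\mathcal{F}_-$-measurable random fixed point $a$ such that 1. $r(\omega)$ is the crack point of $\omega$ for every $\omega$ which admits one;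 2. $a(\omega)\neq r(\omega)$ for almost every $\omega$; 3. for almost every $\omega$, for all $x\in\mathbb{S}^1\setminus\{r(\omega)\}$, $d(\varphi(t,\omega)x,\varphi(t,\omega)a(\omega))\to0$ as $t\to\infty$; 4. the set of invariant measures of $\varphi$ is exactly $\{\lambda\boldsymbol{\delta}_r+(1-\lambda)\boldsymbol{\delta}_a:\lambda\in[0,1]\}$. -/

import Mathlib

open MeasureTheory Filter Topology
open scoped NNReal ENNReal

/-- A stationary memoryless noise over the probability space `(Ω, P)` with time set `T`
(for us, `T = ℕ` or `T = [0, ∞)`): a filtration `ℱ` and a semigroup of `P`-preserving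
time-shifts `θ t`. -/
structure MemorylessNoise (T : Type*) [AddCommMonoid T] [Preorder T]
    {Ω : Type*} [mΩ : MeasurableSpace Ω] (P : Measure Ω) where
  /-- `ℱ t` is the information available between time `0` and time `t`. -/
  ℱ : Filtration T mΩ
  /-- The shift of the noise realisation forward by time `t`. -/
  θ : T → Ω → Ω
  measurePreserving_θ : ∀ t, MeasurePreserving (θ t) P P
  θ_zero : θ 0 = id
  θ_add : ∀ s t, θ (s + t) = θ t ∘ θ s
  /-- `θ t` is `(ℱ (s + t), ℱ s)`-measurable. -/
  measurable_θ : ∀ s t, Measurable[ℱ (s + t), ℱ s] (θ t)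
  /-- `ℱ t` and `θ^{-t} ℱ₊` are independent, where `ℱ₊ = σ(ℱ s : s ∈ T)`. -/
  indep : ∀ t, ProbabilityTheory.Indep (ℱ t) ((⨆ s, ℱ s).comap (θ t)) P

namespace MemorylessNoise

variable {T : Type*} [AddCommMonoid T] [Preorder T] {Ω : Type*} [MeasurableSpace Ω]
  {P : Measure Ω}

/-- The future σ-algebra `ℱ₊ = σ(ℱ t : t ∈ T)`. -/
abbrev future (N : MemorylessNoise T P) : MeasurableSpace Ω := ⨆ t, N.ℱ t

/-- The past σ-algebra `ℱ₋ = σ(θ^t ℱ_t : t ∈ T)`, where `θ^t ℱ_t = {θ^t E : E ∈ ℱ_t}`. -/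
abbrev past (N : MemorylessNoise T P) : MeasurableSpace Ω :=
  MeasurableSpace.generateFrom
    {A | ∃ (t : T) (E : Set Ω), MeasurableSet[N.ℱ t] E ∧ A = N.θ t '' E}

/-- Every `θ t` is an automorphism of the measurable space `Ω` (two-sided time). -/
def IsInvertible (N : MemorylessNoise T P) : Prop :=
  ∀ t, ∃ e : Ω ≃ᵐ Ω, ⇑e = N.θ t

/-- `P` is an ergodic measure of the semigroup `(θ t)`: every measurable set which is invariant
up to null sets under all `θ t` has probability `0` or `1`. -/
def IsErgodic (N : MemorylessNoise T P) : Prop :=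
  ∀ A : Set Ω, MeasurableSet A → (∀ t, N.θ t ⁻¹' A =ᵐ[P] A) → P A = 0 ∨ P A = 1

end MemorylessNoise

/-- A homeomorphism of the circle `ℝ/ℤ` is orientation-preserving if it has a continuous strictly
increasing lift to `ℝ`. -/
def IsOrientationPreserving (f : UnitAddCircle ≃ₜ UnitAddCircle) : Prop :=
  ∃ F : ℝ → ℝ, Continuous F ∧ StrictMono F ∧ ∀ x : ℝ, ((F x : ℝ) : UnitAddCircle) = f x

/-- An (invertible, càdlàg) random dynamical system on the circle `ℝ/ℤ`, driven by the stationary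
memoryless noise `N`. -/
structure CircleRDS {T : Type*} [AddCommMonoid T] [LinearOrder T] [TopologicalSpace T]
    {Ω : Type*} [MeasurableSpace Ω] {P : Measure Ω} (N : MemorylessNoise T P) where
  /-- The time-`t` map `toHomeo t ω` under the noise realisation `ω`. -/
  toHomeo : T → Ω → UnitAddCircle ≃ₜ UnitAddCircle
  orientationPreserving : ∀ t ω, IsOrientationPreserving (toHomeo t ω)
  /-- `(ω, x) ↦ φ(t, ω) x` is `ℱ t ⊗ ℬ`-measurable. -/
  measurable : ∀ t, Measurable[(N.ℱ t).prod (inferInstance : MeasurableSpace UnitAddCircle)]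
    (fun p : Ω × UnitAddCircle => toHomeo t p.1 p.2)
  map_zero : ∀ ω x, toHomeo 0 ω x = x
  map_add : ∀ s t ω x, toHomeo (s + t) ω x = toHomeo t (N.θ s ω) (toHomeo s ω x)
  right_continuous : ∀ (ω : Ω) (u : ℕ → T) (t : T) (x : ℕ → UnitAddCircle) (y : UnitAddCircle),
    Antitone u → Tendsto u atTop (𝓝 t) → Tendsto x atTop (𝓝 y) →
      Tendsto (fun n => toHomeo (u n) ω (x n)) atTop (𝓝 (toHomeo t ω y))
  left_limits : ∃ φl : T → Ω → UnitAddCircle → UnitAddCircle,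
    ∀ (ω : Ω) (u : ℕ → T) (t : T) (x : ℕ → UnitAddCircle) (y : UnitAddCircle),
      StrictMono u → Tendsto u atTop (𝓝 t) → Tendsto x atTop (𝓝 y) →
        Tendsto (fun n => toHomeo (u n) ω (x n)) atTop (𝓝 (φl t ω y))

namespace CircleRDS

variable {T : Type*} [AddCommMonoid T] [LinearOrder T] [TopologicalSpace T]
  {Ω : Type*} [MeasurableSpace Ω] {P : Measure Ω} {N : MemorylessNoise T P}

/-- For all `x, y`, almost surely `d(φ(t, ω) x, φ(t, ω) y) → 0` as `t → ∞`. -/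
def IsSynchronising (φ : CircleRDS N) : Prop :=
  ∀ x y : UnitAddCircle, ∀ᵐ ω ∂P,
    Tendsto (fun t => dist (φ.toHomeo t ω x) (φ.toHomeo t ω y)) atTop (𝓝 0)

/-- For every `x`, almost surely there is an open neighbourhood `U` of `x` such that the Lebesgue
measure of `φ(t, ω) U` tends to `0` as `t → ∞`. -/
def IsEverywhereLocallyStable (φ : CircleRDS N) : Prop :=
  ∀ x : UnitAddCircle, ∀ᵐ ω ∂P, ∃ U : Set UnitAddCircle, IsOpen U ∧ x ∈ U ∧
    Tendsto (fun t => volume (φ.toHomeo t ω '' U)) atTop (𝓝 0)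

/-- Synchronising and everywhere locally stable. -/
def IsStablySynchronising (φ : CircleRDS N) : Prop :=
  φ.IsSynchronising ∧ φ.IsEverywhereLocallyStable

/-- `p` is a crack point of the noise realisation `ω`: for every closed `G` not containing `p`, the
Lebesgue measure of `φ(t, ω) G` tends to `0` as `t → ∞`. -/
def IsCrackPoint (φ : CircleRDS N) (ω : Ω) (p : UnitAddCircle) : Prop :=
  ∀ G : Set UnitAddCircle, IsClosed G → p ∉ G →
    Tendsto (fun t => volume (φ.toHomeo t ω '' G)) atTop (𝓝 0)

/-- `q` is a random fixed point: it is measurable and for each `t`, almost surely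
`φ(t, ω) q(ω) = q(θ^t ω)`. -/
def IsRandomFixedPoint (φ : CircleRDS N) (q : Ω → UnitAddCircle) : Prop :=
  Measurable q ∧ ∀ t, ∀ᵐ ω ∂P, φ.toHomeo t ω (q ω) = q (N.θ t ω)

/-- The skew product `Θ^t (ω, x) = (θ^t ω, φ(t, ω) x)`. -/
def skewProduct (φ : CircleRDS N) (t : T) (p : Ω × UnitAddCircle) : Ω × UnitAddCircle :=
  (N.θ t p.1, φ.toHomeo t p.1 p.2)

/-- `μ` is an invariant probability measure of `φ`: its marginal on `Ω` is `P`, and it is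
invariant under all `Θ^t`. -/
def IsInvariantMeasure (φ : CircleRDS N) (μ : Measure (Ω × UnitAddCircle)) : Prop :=
  μ.fst = P ∧ ∀ t, MeasurePreserving (φ.skewProduct t) μ μ

end CircleRDS

/-- The measure `𝛅_q (A) = P (ω : (ω, q ω) ∈ A)` on `Ω × 𝕊¹`. -/
noncomputable def graphMeasure {Ω : Type*} [MeasurableSpace Ω] (P : Measure Ω)
    (q : Ω → UnitAddCircle) : Measure (Ω × UnitAddCircle) :=
  P.map (fun ω => (ω, q ω))

namespace CircleRDS

variable {T : Type*} [AddCommMonoid T] [LinearOrder T] [TopologicalSpace T]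
  {Ω : Type*} [MeasurableSpace Ω] {P : Measure Ω} {N : MemorylessNoise T P}

/-- `(a, r)` represents a global random attractor-repeller pair of `φ`. -/
structure IsGlobalAttractorRepellerPair (φ : CircleRDS N) (a r : Ω → UnitAddCircle) : Prop where
  /-- Almost every `ω` admits a crack point. -/
  ae_contractive : ∀ᵐ ω ∂P, ∃ p, φ.IsCrackPoint ω p
  /-- `r` sends every `ω` that admits a crack point to its crack point. -/
  repeller_eq : ∀ ω p, φ.IsCrackPoint ω p → r ω = p
  repeller_fixed : φ.IsRandomFixedPoint r
  repeller_future : Measurable[N.future] r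
  attractor_fixed : φ.IsRandomFixedPoint a
  attractor_past : Measurable[N.past] a
  ae_ne : ∀ᵐ ω ∂P, a ω ≠ r ω
  /-- Every trajectory not starting at the repeller converges to that of the attractor. -/
  attracts : ∀ᵐ ω ∂P, ∀ x, x ≠ r ω →
    Tendsto (fun t => dist (φ.toHomeo t ω x) (φ.toHomeo t ω (a ω))) atTop (𝓝 0)
  /-- The invariant measures are exactly the convex combinations of `𝛅_r` and `𝛅_a`. -/
  invariant_iff : ∀ μ : Measure (Ω × UnitAddCircle), φ.IsInvariantMeasure μ ↔
    ∃ c : ℝ≥0∞, c ≤ 1 ∧ μ = c • graphMeasure P r + (1 - c) • graphMeasure P a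

/-- `φ` is simple if it has a global random attractor-repeller pair. -/
def IsSimple (φ : CircleRDS N) : Prop :=
  ∃ a r : Ω → UnitAddCircle, φ.IsGlobalAttractorRepellerPair a r

end CircleRDS

/-! A homeomorphism sends arcs to arcs, so the volume of the image of an arc bounds its diameter,
and local stability says that small arcs contract in diameter. By compactness one radius serves all
centres with probability close to 1. By independence it also serves a centre determined by the noise
up to time `t`, when the noise after `t` acts on it (`exists_forall_measure_shift_le`).

Repeller: synchronisation brings the endpoints of an arc together. Then the arc or its complement
has been mapped into a small ball, which is likely to contract from then on. Hence almost surely the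
arc or its complement contracts (`ae_contracts_or`). Contracting arcs cannot cover the circle, so at
every scale the complement of some small ball contracts; a limit of the centres of these balls is
the crack point.

Attractor: the positions at time `0` of trajectories started ever further in the past are Cauchy in
probability (`exists_forall_measure_dist_pullback_le`), and `a` is their limit. A ball of fixed
radius about such a position is likely to contract under the future noise, so it excludes the crack
point; hence `a ≠ r`.

Invariant measures: the graph of `r` and its complement are both invariant, and ergodicity makes the
marginal of each piece a multiple of `P`. Off the graph of `r` all trajectories approach `a`, which
for an invariant measure forces concentration on the graph of `a`. -/

/-! ### Distance, antipodes and arcs on the circle -/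

namespace UnitAddCircle

theorem coe_eq_coe_iff {a b : ℝ} : (a : UnitAddCircle) = b ↔ ∃ m : ℤ, a - b = m := by
  rw [← sub_eq_zero, ← AddCircle.coe_sub, AddCircle.coe_eq_zero_iff]
  simp [eq_comm]

theorem dist_coe_le (a b : ℝ) : dist (a : UnitAddCircle) b ≤ |a - b| := by
  rw [dist_eq_norm, ← AddCircle.coe_sub, UnitAddCircle.norm_eq]
  simpa using round_le (a - b) 0

theorem exists_coe_eq_and_dist_eq (y : UnitAddCircle) (c : ℝ) :
    ∃ z : ℝ, (z : UnitAddCircle) = y ∧ dist y c = |z - c| := by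
  obtain ⟨z, rfl⟩ := QuotientAddGroup.mk_surjective y
  refine ⟨z - round (z - c), ?_, ?_⟩
  · exact coe_eq_coe_iff.2 ⟨-round (z - c), by push_cast; ring⟩
  · change dist (z : UnitAddCircle) c = _
    rw [dist_eq_norm, ← AddCircle.coe_sub, UnitAddCircle.norm_eq]
    congr 1
    ring

theorem dist_le_half (x y : UnitAddCircle) : dist x y ≤ 1 / 2 := by
  rw [dist_eq_norm]
  simpa using AddCircle.norm_le_half_period 1 (x := x - y) one_ne_zero

theorem dist_add_half (y c : UnitAddCircle) :
    dist y (c + ((1 / 2 : ℝ) : UnitAddCircle)) = 1 / 2 - dist y c := by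
  obtain ⟨c, rfl⟩ := QuotientAddGroup.mk_surjective c
  change dist y ((c : UnitAddCircle) + ((1 / 2 : ℝ) : UnitAddCircle)) = 1 / 2 - dist y c
  obtain ⟨z, rfl, hz⟩ := exists_coe_eq_and_dist_eq y c
  have hle := dist_le_half (z : UnitAddCircle) c
  have key : ∀ s : ℝ, |s| ≤ 1 / 2 → ‖(s : UnitAddCircle)‖ = |s| := fun s hs =>
    (AddCircle.norm_coe_eq_abs_iff 1 one_ne_zero).2 (by simpa using hs)
  rw [hz] at hle ⊢
  rw [dist_eq_norm, ← AddCircle.coe_add, ← AddCircle.coe_sub]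
  rcases le_total 0 (z - c) with h | h
  · rw [abs_of_nonneg h] at hle ⊢
    rw [key, abs_of_nonpos] <;> [skip; linarith; skip]
    · ring
    · rw [abs_le]; constructor <;> linarith
  · rw [abs_of_nonpos h] at hle ⊢
    have : ((z - (c + 1 / 2) : ℝ) : UnitAddCircle) = ((z - c + 1 / 2 : ℝ) : UnitAddCircle) :=
      coe_eq_coe_iff.2 ⟨-1, by push_cast; ring⟩
    rw [this, key, abs_of_nonneg] <;> [skip; linarith; skip]
    · ring
    · rw [abs_le]; constructor <;> linarith

theorem ball_add_half (c : UnitAddCircle) (ε : ℝ) :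
    Metric.ball (c + ((1 / 2 : ℝ) : UnitAddCircle)) (1 / 2 - ε) = (Metric.closedBall c ε)ᶜ := by
  ext y
  simp [dist_add_half, -one_div]

theorem closedBall_add_half (c : UnitAddCircle) (ε : ℝ) :
    Metric.closedBall (c + ((1 / 2 : ℝ) : UnitAddCircle)) (1 / 2 - ε) = (Metric.ball c ε)ᶜ := by
  ext y
  simp only [Metric.mem_closedBall, dist_add_half, Set.mem_compl_iff, Metric.mem_ball, not_lt]
  constructor <;> intro h <;> linarith

theorem volume_univ_eq_one : volume (Set.univ : Set UnitAddCircle) = 1 := by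
  simp

/-- The arc contains the closed ball about its midpoint of radius `(b - a) / 2`, whose volume is
`min 1 (b - a)`. -/
theorem ofReal_dist_le_volume_image_Icc {a b : ℝ} (hab : a ≤ b) :
    ENNReal.ofReal (dist (a : UnitAddCircle) b) ≤
      volume ((fun x : ℝ => (x : UnitAddCircle)) '' Set.Icc a b) := by
  have hsub : Metric.closedBall (((a + b) / 2 : ℝ) : UnitAddCircle) ((b - a) / 2) ⊆
      (fun x : ℝ => (x : UnitAddCircle)) '' Set.Icc a b := by
    intro y hy
    obtain ⟨z, rfl, hz⟩ := exists_coe_eq_and_dist_eq y ((a + b) / 2)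
    rw [Metric.mem_closedBall, hz, abs_le] at hy
    exact ⟨z, ⟨by linarith, by linarith⟩, rfl⟩
  refine le_trans ?_ (measure_mono hsub)
  rw [AddCircle.volume_closedBall]
  apply ENNReal.ofReal_le_ofReal
  have h1 := dist_coe_le a b
  rw [abs_of_nonpos (by linarith)] at h1
  have h2 := dist_le_half (a : UnitAddCircle) b
  rw [le_min_iff]
  constructor <;> linarith

end UnitAddCircle

/-! ### Images of arcs under orientation-preserving homeomorphisms -/

namespace IsOrientationPreserving

variable {f : UnitAddCircle ≃ₜ UnitAddCircle}

open UnitAddCircle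

/-- By the intermediate value theorem for a lift, the image of the ball contains a whole arc from `f
y` to `f z`. -/
theorem ofReal_dist_le_volume_image_ball (hf : IsOrientationPreserving f) {c : UnitAddCircle}
    {ε : ℝ} {y z : UnitAddCircle} (hy : y ∈ Metric.ball c ε) (hz : z ∈ Metric.ball c ε) :
    ENNReal.ofReal (dist (f y) (f z)) ≤ volume (f '' Metric.ball c ε) := by
  obtain ⟨F, hFc, hFm, hF⟩ := hf
  obtain ⟨c, rfl⟩ := QuotientAddGroup.mk_surjective c
  change y ∈ Metric.ball (c : UnitAddCircle) ε at hy
  change z ∈ Metric.ball (c : UnitAddCircle) ε at hz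
  obtain ⟨y, rfl, hy'⟩ := exists_coe_eq_and_dist_eq y c
  obtain ⟨z, rfl, hz'⟩ := exists_coe_eq_and_dist_eq z c
  rw [Metric.mem_ball, hy', abs_lt] at hy
  rw [Metric.mem_ball, hz', abs_lt] at hz
  clear hy' hz'
  wlog hyz : y ≤ z generalizing y z
  · rw [dist_comm]
    exact this z hz y hy (le_of_not_ge hyz)
  rw [← hF, ← hF]
  refine (ofReal_dist_le_volume_image_Icc (hFm.monotone hyz)).trans (measure_mono ?_)
  rintro _ ⟨w, hw, rfl⟩
  obtain ⟨v, hv, rfl⟩ := intermediate_value_Icc hyz hFc.continuousOn hw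
  refine ⟨v, ?_, (hF v).symm⟩
  rw [Metric.mem_ball]
  refine (dist_coe_le _ _).trans_lt ?_
  rw [abs_lt]
  constructor <;> linarith [hv.1, hv.2]

/-- The increment over a period is a positive integer. If it were at least `2`, the lift would take
the value `F x + 1` strictly inside the period, against injectivity of `f`. -/
theorem lift_add_one {F : ℝ → ℝ} (hFc : Continuous F) (hFm : StrictMono F)
    (hF : ∀ x : ℝ, ((F x : ℝ) : UnitAddCircle) = f x) (x : ℝ) : F (x + 1) = F x + 1 := by
  have hone : ((x + 1 : ℝ) : UnitAddCircle) = (x : UnitAddCircle) :=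
    coe_eq_coe_iff.2 ⟨1, by push_cast; ring⟩
  obtain ⟨m, hm⟩ := coe_eq_coe_iff.1 ((hF (x + 1)).trans ((congrArg f hone).trans (hF x).symm))
  have hlt : F x < F (x + 1) := hFm (by linarith)
  have hm0 : 0 < m := by
    have : (0 : ℝ) < m := by linarith
    exact_mod_cast this
  by_contra hne
  have hm2 : 2 ≤ m := by
    have : m ≠ 1 := by
      rintro rfl
      apply hne
      push_cast at hm
      linarith
    omega
  have hm2' : (2 : ℝ) ≤ m := by exact_mod_cast hm2
  obtain ⟨v, hv, hFv⟩ := intermediate_value_Icc (show x ≤ x + 1 by linarith) hFc.continuousOn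
    (show F x + 1 ∈ Set.Icc (F x) (F (x + 1)) from ⟨by linarith, by linarith⟩)
  have hv1 : x < v := hFm.lt_iff_lt.1 (by linarith)
  have hv2 : v < x + 1 := hFm.lt_iff_lt.1 (by linarith)
  have hfv : f v = f x := by
    rw [← hF, ← hF]
    exact coe_eq_coe_iff.2 ⟨1, by rw [hFv]; push_cast; ring⟩
  obtain ⟨k, hk⟩ := coe_eq_coe_iff.1 (f.injective hfv)
  have h0 : (0 : ℝ) < k := by linarith
  have h1 : (k : ℝ) < 1 := by linarith
  have h0' : 0 < k := by exact_mod_cast h0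
  have h1' : k < 1 := by exact_mod_cast h1
  omega

/-- If the endpoints of an arc are mapped close to each other, then either the arc or the
complementary arc is mapped into a small ball. -/
theorem image_ball_subset_or (hf : IsOrientationPreserving f) (c : UnitAddCircle) {ε δ : ℝ}
    (hδ' : δ ≤ 1 / 2) (hε : 0 < ε) (hε' : ε < 1 / 2)
    (h : dist (f (c - (ε : UnitAddCircle))) (f (c + (ε : UnitAddCircle))) < δ) :
    f '' Metric.ball c ε ⊆ Metric.ball (f (c + (ε : UnitAddCircle))) δ ∨
    f '' Metric.ball (c + ((1 / 2 : ℝ) : UnitAddCircle)) (1 / 2 - ε) ⊆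
      Metric.ball (f (c + (ε : UnitAddCircle))) δ := by
  obtain ⟨F, hFc, hFm, hF⟩ := hf
  obtain ⟨c, rfl⟩ := QuotientAddGroup.mk_surjective c
  change dist (f ((c : UnitAddCircle) - (ε : UnitAddCircle)))
    (f ((c : UnitAddCircle) + (ε : UnitAddCircle))) < δ at h
  change f '' Metric.ball (c : UnitAddCircle) ε ⊆
      Metric.ball (f ((c : UnitAddCircle) + (ε : UnitAddCircle))) δ ∨
    f '' Metric.ball ((c : UnitAddCircle) + ((1 / 2 : ℝ) : UnitAddCircle)) (1 / 2 - ε) ⊆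
      Metric.ball (f ((c : UnitAddCircle) + (ε : UnitAddCircle))) δ
  rw [← AddCircle.coe_sub, ← AddCircle.coe_add, ← hF, ← hF] at h
  rw [← AddCircle.coe_add, ← AddCircle.coe_add, ← hF]
  have hone := lift_add_one hFc hFm hF (c - ε)
  have hlt : F (c - ε) < F (c + ε) := hFm (by linarith)
  have hlt' : F (c + ε) < F (c - ε + 1) := hFm (by linarith)
  have key : ∀ u v : ℝ, u < v → ∀ y ∈ Metric.ball (((u + v) / 2 : ℝ) : UnitAddCircle)
      ((v - u) / 2), ∃ w, u < w ∧ w < v ∧ (w : UnitAddCircle) = y := by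
    intro u v huv y hy
    obtain ⟨w, hw, hw'⟩ := exists_coe_eq_and_dist_eq y ((u + v) / 2)
    rw [Metric.mem_ball, hw', abs_lt] at hy
    exact ⟨w, by linarith, by linarith, hw⟩
  rw [dist_comm, dist_eq_norm, ← AddCircle.coe_sub, UnitAddCircle.norm_eq] at h
  have hd0 : 0 < F (c + ε) - F (c - ε) := by linarith
  have hd1 : F (c + ε) - F (c - ε) < 1 := by linarith
  rw [abs_lt] at h
  have hr0 : (-1 : ℝ) < round (F (c + ε) - F (c - ε)) := by linarith [h.1, h.2]
  have hr1 : (round (F (c + ε) - F (c - ε)) : ℝ) < 2 := by linarith [h.1, h.2]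
  have hr : round (F (c + ε) - F (c - ε)) = 0 ∨ round (F (c + ε) - F (c - ε)) = 1 := by
    have h0 : -1 < round (F (c + ε) - F (c - ε)) := by exact_mod_cast hr0
    have h1 : round (F (c + ε) - F (c - ε)) < 2 := by exact_mod_cast hr1
    omega
  -- The lifted arc has length in `(0, 1)`. Nearest integer `0` means that the arc itself is short,
  -- `1` that the complementary arc is.
  rcases hr with hr | hr <;> rw [hr] at h <;> push_cast at h
  · left
    rintro _ ⟨y, hy, rfl⟩
    obtain ⟨w, hw1, hw2, rfl⟩ := key (c - ε) (c + ε) (by linarith) y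
      (by convert hy using 2 <;> [congr 1; skip] <;> ring)
    rw [← hF, Metric.mem_ball]
    refine (dist_coe_le _ _).trans_lt ?_
    have := hFm hw1
    have := hFm hw2
    rw [abs_lt]
    constructor <;> linarith
  · right
    rintro _ ⟨y, hy, rfl⟩
    -- The complementary arc runs from `c + ε` to `c - ε + 1`, with midpoint `c + 1 / 2` and
    -- half-length `1 / 2 - ε`.
    obtain ⟨w, hw1, hw2, rfl⟩ := key (c + ε) (c - ε + 1) (by linarith) y
      (by convert hy using 2 <;> [congr 1; skip] <;> ring)
    rw [← hF, Metric.mem_ball]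
    refine (dist_coe_le _ _).trans_lt ?_
    have := hFm hw1
    have := hFm hw2
    rw [abs_lt]
    constructor <;> linarith

end IsOrientationPreserving

/-! ### Time sets -/

/-- The properties of the time sets `ℕ` and `[0, ∞)` used for circle random dynamical systems. -/
class IsTimeSet (T : Type*) [AddCommMonoid T] [LinearOrder T] [TopologicalSpace T] : Prop where
  -- Both inequalities matter: `Contracts.of_image` goes from the shifted system back to the
  -- original one, `IsCrackPoint.map` forward.
  map_add_atTop : ∀ t : T, map (fun s => t + s) atTop = atTop
  exists_tendsto_nsmul : ∃ e : T, Tendsto (fun n : ℕ => n • e) atTop atTop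
  exists_countable : ∃ S : Set T, S.Countable ∧ ∀ t, ∃ u : ℕ → T, Antitone u ∧
    (∀ n, u n ∈ S ∧ t ≤ u n) ∧ Tendsto u atTop (𝓝 t)

namespace IsTimeSet

theorem map_add_atTop_of_canonicallyOrdered {T : Type*} [AddCommMonoid T] [LinearOrder T]
    [IsOrderedAddMonoid T] [CanonicallyOrderedAdd T] (t : T) :
    map (fun s => t + s) atTop = (atTop : Filter T) := by
  have : Nonempty T := ⟨0⟩
  apply le_antisymm
  · exact tendsto_atTop_mono (fun s => le_add_self) tendsto_id
  · intro A hA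
    rw [mem_map, mem_atTop_sets] at hA
    obtain ⟨a, ha⟩ := hA
    refine mem_atTop_sets.2 ⟨t + a, fun b hb => ?_⟩
    obtain ⟨c, rfl⟩ := exists_add_of_le hb
    rw [add_assoc]
    exact ha _ le_self_add

instance nat : IsTimeSet ℕ where
  map_add_atTop := map_add_atTop_of_canonicallyOrdered
  exists_tendsto_nsmul := ⟨1, by simpa using! tendsto_id⟩
  exists_countable := ⟨Set.univ, Set.to_countable _, fun t => ⟨fun _ => t, fun _ _ _ => le_rfl,
    fun _ => ⟨trivial, le_rfl⟩, tendsto_const_nhds⟩⟩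

instance nnreal : IsTimeSet ℝ≥0 where
  map_add_atTop := map_add_atTop_of_canonicallyOrdered
  exists_tendsto_nsmul := ⟨1, by simpa using tendsto_natCast_atTop_atTop⟩
  exists_countable := by
    obtain ⟨S, hS, hd⟩ := TopologicalSpace.exists_countable_dense ℝ≥0
    refine ⟨S, hS, fun t => ?_⟩
    obtain ⟨u, hu, hu', hut⟩ := hd.exists_seq_strictAnti_tendsto t
    exact ⟨u, hu.antitone, fun n => ⟨(hu' n).2, (hu' n).1.le⟩, hut⟩

end IsTimeSet

/-! ### Contraction and crack points for a fixed noise realisation -/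

namespace CircleRDS

variable {T : Type*} [AddCommMonoid T] [LinearOrder T] [TopologicalSpace T]
  {Ω : Type*} [MeasurableSpace Ω] {P : Measure Ω} {N : MemorylessNoise T P}

/-- The diameter of the image of `B` under `φ(t, ω)` tends to `0` as `t → ∞`. -/
def Contracts (φ : CircleRDS N) (ω : Ω) (B : Set UnitAddCircle) : Prop :=
  ∀ δ > 0, ∀ᶠ t in atTop, ∀ y ∈ B, ∀ z ∈ B,
    dist (φ.toHomeo t ω y) (φ.toHomeo t ω z) ≤ δ

variable {φ : CircleRDS N} {ω : Ω} {p q : UnitAddCircle}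

theorem Contracts.mono {B B' : Set UnitAddCircle} (h : φ.Contracts ω B') (hB : B ⊆ B') :
    φ.Contracts ω B := fun δ hδ =>
  (h δ hδ).mono fun _ ht y hy z hz => ht y (hB hy) z (hB hz)

theorem Contracts.tendsto_dist {B : Set UnitAddCircle} (h : φ.Contracts ω B) {y z : UnitAddCircle}
    (hy : y ∈ B) (hz : z ∈ B) :
    Tendsto (fun t => dist (φ.toHomeo t ω y) (φ.toHomeo t ω z)) atTop (𝓝 0) := by
  rw [Metric.tendsto_nhds]
  intro ε hε
  filter_upwards [h (ε / 2) (by positivity)] with t ht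
  rw [Real.dist_0_eq_abs, abs_of_nonneg dist_nonneg]
  linarith [ht y hy z hz]

theorem Contracts.tendsto_volume {B : Set UnitAddCircle} (h : φ.Contracts ω B) :
    Tendsto (fun t => volume (φ.toHomeo t ω '' B)) atTop (𝓝 0) := by
  rcases B.eq_empty_or_nonempty with rfl | ⟨y, hy⟩
  · simp
  rw [ENNReal.tendsto_nhds_zero]
  intro ε hε
  obtain ⟨δ, hδ, hδε⟩ : ∃ δ : ℝ, 0 < δ ∧ ENNReal.ofReal (2 * δ) ≤ ε := by
    rcases eq_or_ne ε ⊤ with rfl | hε'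
    · exact ⟨1, one_pos, le_top⟩
    · refine ⟨ε.toReal / 2, half_pos (ENNReal.toReal_pos hε.ne' hε'), ?_⟩
      rw [mul_div_cancel₀ _ two_ne_zero, ENNReal.ofReal_toReal hε']
  filter_upwards [h δ hδ] with t ht
  calc volume (φ.toHomeo t ω '' B)
      ≤ volume (Metric.closedBall (φ.toHomeo t ω y) δ) := by
        apply measure_mono
        rintro _ ⟨z, hz, rfl⟩
        exact ht z hz y hy
    _ ≤ ENNReal.ofReal (2 * δ) := by
        rw [AddCircle.volume_closedBall]
        exact ENNReal.ofReal_le_ofReal (min_le_right _ _)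
    _ ≤ ε := hδε

/-- A converse to `Contracts.tendsto_volume` that relies on the ball being an arc. -/
theorem contracts_ball_of_tendsto_volume {c : UnitAddCircle} {ε : ℝ} {U : Set UnitAddCircle}
    (hU : Metric.ball c ε ⊆ U)
    (h : Tendsto (fun t => volume (φ.toHomeo t ω '' U)) atTop (𝓝 0)) :
    φ.Contracts ω (Metric.ball c ε) := by
  intro δ hδ
  filter_upwards [(ENNReal.tendsto_nhds_zero.1 h) (ENNReal.ofReal δ) (by simpa using hδ)]
    with t ht y hy z hz
  refine (ENNReal.ofReal_le_ofReal_iff hδ.le).1 (le_trans ?_ ht)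
  exact ((φ.orientationPreserving t ω).ofReal_dist_le_volume_image_ball hy hz).trans
    (measure_mono (Set.image_mono hU))

theorem Contracts.of_image [IsTimeSet T] {B B' : Set UnitAddCircle} {s : T}
    (h : φ.Contracts (N.θ s ω) B') (hB : φ.toHomeo s ω '' B ⊆ B') : φ.Contracts ω B := by
  intro δ hδ
  rw [← IsTimeSet.map_add_atTop s, eventually_map]
  filter_upwards [h δ hδ] with t ht y hy z hz
  rw [φ.map_add, φ.map_add]
  exact ht _ (hB ⟨y, hy, rfl⟩) _ (hB ⟨z, hz, rfl⟩)

/-- The images cover the circle at every time, so their volumes always sum to at least `1`. -/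
theorem not_tendsto_volume_of_cover {ι : Type*} (s : Finset ι) (B : ι → Set UnitAddCircle)
    (hB : ∀ x, ∃ i ∈ s, x ∈ B i) :
    ¬ ∀ i ∈ s, Tendsto (fun t => volume (φ.toHomeo t ω '' B i)) atTop (𝓝 0) := by
  have : Nonempty T := ⟨0⟩
  intro h
  have hsum := tendsto_finsetSum s h
  rw [Finset.sum_const_zero] at hsum
  have hle : ∀ t, 1 ≤ ∑ i ∈ s, volume (φ.toHomeo t ω '' B i) := by
    intro t
    rw [← UnitAddCircle.volume_univ_eq_one]
    refine le_trans (measure_mono ?_) (measure_biUnion_finset_le s _)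
    intro x _
    obtain ⟨y, rfl⟩ := (φ.toHomeo t ω).surjective x
    obtain ⟨i, hi, hy⟩ := hB y
    exact Set.mem_iUnion₂.2 ⟨i, hi, y, hy, rfl⟩
  have := ge_of_tendsto' hsum hle
  simp at this

theorem not_tendsto_volume_of_union {A B : Set UnitAddCircle} (h : A ∪ B = Set.univ)
    (hA : Tendsto (fun t => volume (φ.toHomeo t ω '' A)) atTop (𝓝 0)) :
    ¬ Tendsto (fun t => volume (φ.toHomeo t ω '' B)) atTop (𝓝 0) := by
  intro hB
  refine not_tendsto_volume_of_cover (φ := φ) (ω := ω) Finset.univ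
    (fun b : Bool => if b then A else B) (fun x => ?_) ?_
  · rcases (h.symm ▸ Set.mem_univ x : x ∈ A ∪ B) with hx | hx
    · exact ⟨true, Finset.mem_univ _, by simpa using hx⟩
    · exact ⟨false, Finset.mem_univ _, by simpa using hx⟩
  · rintro (_ | _) _
    · simpa using hB
    · simpa using hA

/-- For distinct `p` and `q`, the points far from `p` and the points far from `q` would be two
vanishing sets covering the circle. -/
theorem IsCrackPoint.eq (hp : φ.IsCrackPoint ω p) (hq : φ.IsCrackPoint ω q) : p = q := by
  by_contra hne
  have hd : 0 < dist p q := dist_pos.2 hne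
  refine not_tendsto_volume_of_union (φ := φ) (ω := ω) (A := {x | dist p q / 2 ≤ dist x p})
    (B := {x | dist p q / 2 ≤ dist x q}) ?_ (hp _ ?_ ?_) (hq _ ?_ ?_)
  · rw [Set.eq_univ_iff_forall]
    intro x
    by_contra hx
    simp only [Set.mem_union, Set.mem_ofPred_eq, not_or, not_le] at hx
    have := dist_triangle_left p q x
    linarith
  · exact isClosed_le continuous_const (continuous_id.dist continuous_const)
  · simpa using hd
  · exact isClosed_le continuous_const (continuous_id.dist continuous_const)
  · simpa using hd

theorem IsCrackPoint.contracts_ball (hp : φ.IsCrackPoint ω p) {c : UnitAddCircle} {ε : ℝ}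
    (h : p ∉ Metric.closedBall c ε) : φ.Contracts ω (Metric.ball c ε) :=
  contracts_ball_of_tendsto_volume Metric.ball_subset_closedBall (hp _ Metric.isClosed_closedBall h)

theorem IsCrackPoint.notMem_of_contracts (hp : φ.IsCrackPoint ω p) {U : Set UnitAddCircle}
    (hU : IsOpen U) (h : φ.Contracts ω U) : p ∉ U := fun hpU =>
  not_tendsto_volume_of_union (φ := φ) (Set.union_compl_self U) h.tendsto_volume
    (hp _ hU.isClosed_compl (by simpa using hpU))

theorem IsCrackPoint.tendsto_dist (hp : φ.IsCrackPoint ω p) {x y : UnitAddCircle} (hx : x ≠ p)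
    (hy : y ≠ p) :
    Tendsto (fun t => dist (φ.toHomeo t ω x) (φ.toHomeo t ω y)) atTop (𝓝 0) := by
  obtain ⟨ε, hε, hεm⟩ := exists_between (lt_min (dist_pos.2 hx) (dist_pos.2 hy))
  rw [lt_min_iff] at hεm
  -- This antipodal ball is the complement of the closed `ε`-ball about `p`; it contains both `x`
  -- and `y`.
  have h : φ.Contracts ω (Metric.ball (p + ((1 / 2 : ℝ) : UnitAddCircle)) (1 / 2 - ε)) := by
    apply hp.contracts_ball
    rw [UnitAddCircle.closedBall_add_half]
    simpa using hε
  rw [UnitAddCircle.ball_add_half] at h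
  exact h.tendsto_dist (by simpa using hεm.1) (by simpa using hεm.2)

theorem IsCrackPoint.map [IsTimeSet T] (hp : φ.IsCrackPoint ω p) (s : T) :
    φ.IsCrackPoint (N.θ s ω) (φ.toHomeo s ω p) := by
  intro G hG hpG
  have h := hp (φ.toHomeo s ω ⁻¹' G) (hG.preimage (φ.toHomeo s ω).continuous) hpG
  rw [← IsTimeSet.map_add_atTop s, tendsto_map'_iff] at h
  refine h.congr fun t => ?_
  simp only [Function.comp]
  congr 1
  ext x
  constructor
  · rintro ⟨y, hy, rfl⟩
    exact ⟨_, hy, (φ.map_add s t ω y).symm⟩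
  · rintro ⟨y, hy, rfl⟩
    obtain ⟨z, rfl⟩ := (φ.toHomeo s ω).surjective y
    exact ⟨z, hy, φ.map_add s t ω z⟩

/-- Small radii used to approximate points of the circle. -/
noncomputable def radius (k : ℕ) : ℝ := 1 / ((k : ℝ) + 3)

theorem radius_pos (k : ℕ) : 0 < radius k := by
  unfold radius
  positivity

/-- The `+ 3` in `radius` secures this strict bound, which `image_ball_subset_or` needs. -/
theorem radius_lt_half (k : ℕ) : radius k < 1 / 2 := by
  unfold radius
  apply one_div_lt_one_div_of_lt two_pos
  have : (0 : ℝ) ≤ k := k.cast_nonneg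
  linarith

theorem tendsto_radius : Tendsto radius atTop (𝓝 0) := by
  unfold radius
  exact tendsto_const_nhds.div_atTop
    (tendsto_atTop_add_const_right _ _ tendsto_natCast_atTop_atTop)

theorem exists_denseSeq_ball (x : UnitAddCircle) {ε : ℝ} (hε : 0 < ε) :
    ∃ i, x ∈ Metric.ball (TopologicalSpace.denseSeq UnitAddCircle i) ε := by
  obtain ⟨i, hi⟩ := (TopologicalSpace.denseRange_denseSeq UnitAddCircle).exists_dist_lt x hε
  exact ⟨i, hi⟩

open TopologicalSpace in
-- Only countably many contraction events occur on the right, which makes the existence of a crack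
-- point a measurable event.
theorem exists_isCrackPoint_iff : (∃ p, φ.IsCrackPoint ω p) ↔
    ∀ k, ∃ i, φ.Contracts ω (Metric.ball
      (denseSeq UnitAddCircle i + ((1 / 2 : ℝ) : UnitAddCircle)) (1 / 2 - radius k)) := by
  constructor
  · rintro ⟨p, hp⟩ k
    obtain ⟨i, hi⟩ := exists_denseSeq_ball p (radius_pos k)
    refine ⟨i, hp.contracts_ball ?_⟩
    rw [UnitAddCircle.closedBall_add_half]
    simpa using hi
  · intro h
    choose i hi using h
    -- The crack point is a limit of the centres of the excluded balls. A closed set missing it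
    -- eventually misses one of these balls.
    obtain ⟨p, -, ψ, hψ, hp⟩ := isCompact_univ.tendsto_subseq
      (fun k => Set.mem_univ (denseSeq UnitAddCircle (i k)))
    refine ⟨p, fun G hG hpG => ?_⟩
    obtain ⟨η, hη, hηG⟩ := Metric.mem_nhds_iff.1 (hG.isOpen_compl.mem_nhds hpG)
    have h1 := Metric.tendsto_nhds.1 hp (η / 2) (by positivity)
    have h2 := ((tendsto_radius.comp hψ.tendsto_atTop).eventually
      (gt_mem_nhds (show 0 < η / 2 by positivity)))
    obtain ⟨k, hk1, hk2⟩ := (h1.and h2).exists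
    refine ((hi (ψ k)).mono ?_).tendsto_volume
    rw [UnitAddCircle.ball_add_half]
    intro x hxG hx
    refine hηG ?_ hxG
    simp only [Function.comp] at hk1 hk2
    rw [Metric.mem_closedBall] at hx
    rw [Metric.mem_ball]
    linarith [dist_triangle x (denseSeq UnitAddCircle (i (ψ k))) p]

open TopologicalSpace in
/-- If every small ball or its complement contracts, then there is a crack point. -/
theorem exists_isCrackPoint_of_forall_or
    (h : ∀ k i, φ.Contracts ω (Metric.ball (denseSeq UnitAddCircle i) (radius k)) ∨
      φ.Contracts ω (Metric.ball (denseSeq UnitAddCircle i + ((1 / 2 : ℝ) : UnitAddCircle))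
        (1 / 2 - radius k))) :
    ∃ p, φ.IsCrackPoint ω p := by
  rw [exists_isCrackPoint_iff]
  intro k
  by_contra! hcon
  obtain ⟨s, hs⟩ := isCompact_univ.elim_finite_subcover
    (fun i => Metric.ball (denseSeq UnitAddCircle i) (radius k)) (fun _ => Metric.isOpen_ball)
    (fun x _ => Set.mem_iUnion.2 (exists_denseSeq_ball x (radius_pos k)))
  refine not_tendsto_volume_of_cover (φ := φ) (ω := ω) s
    (fun i => Metric.ball (denseSeq UnitAddCircle i) (radius k)) (fun x => ?_)
    (fun i _ => ((h k i).resolve_right (hcon i)).tendsto_volume)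
  simpa using hs (Set.mem_univ x)

end CircleRDS

/-! ### Independence of past and future noise -/

/-- The joint law is a product, so by Fubini the bound on every section integrates to the same
bound. -/
theorem measure_prodMk_mem_le_of_indepFun {Ω X Y : Type*} [MeasurableSpace Ω] [MeasurableSpace X]
    [MeasurableSpace Y] {P : Measure Ω} [IsProbabilityMeasure P] {V : Ω → Y} {Z : Ω → X}
    (hV : Measurable V) (hZ : Measurable Z) (h : ProbabilityTheory.IndepFun V Z P)
    {W : Set (Y × X)} (hW : MeasurableSet W) {η : ℝ≥0∞} (hη : ∀ x, P {ω | (V ω, x) ∈ W} ≤ η) :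
    P {ω | (V ω, Z ω) ∈ W} ≤ η := by
  have h1 := (ProbabilityTheory.indepFun_iff_map_prod_eq_prod_map_map hV.aemeasurable
    hZ.aemeasurable).1 h
  have : IsProbabilityMeasure (P.map Z) := Measure.isProbabilityMeasure_map hZ.aemeasurable
  have : IsProbabilityMeasure (P.map V) := Measure.isProbabilityMeasure_map hV.aemeasurable
  have h2 : P {ω | (V ω, Z ω) ∈ W} = (P.map fun ω => (V ω, Z ω)) W :=
    (Measure.map_apply (hV.prodMk hZ) hW).symm
  rw [h2, h1, Measure.prod_apply_symm hW]
  calc ∫⁻ x, (P.map V) ((fun y => (y, x)) ⁻¹' W) ∂(P.map Z)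
      ≤ ∫⁻ _, η ∂(P.map Z) := by
        apply lintegral_mono
        intro x
        dsimp only
        rw [Measure.map_apply hV (measurable_prodMk_right hW)]
        exact hη x
    _ = η := by simp

theorem tendsto_measure_le_of_tendsto_ae {Ω : Type*} [MeasurableSpace Ω] {P : Measure Ω}
    [IsFiniteMeasure P] {f : ℕ → Ω → ℝ} (hm : ∀ n, Measurable (f n)) (h0 : ∀ n ω, 0 ≤ f n ω)
    (h : ∀ᵐ ω ∂P, Tendsto (fun n => f n ω) atTop (𝓝 0)) {δ : ℝ} (hδ : 0 < δ) :
    Tendsto (fun n => P {ω | δ ≤ f n ω}) atTop (𝓝 0) := by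
  have := tendstoInMeasure_iff_dist.1 (tendstoInMeasure_of_tendsto_ae (g := fun _ => (0 : ℝ))
    (fun n => (hm n).aestronglyMeasurable) h) δ hδ
  refine this.congr fun n => ?_
  congr 1
  ext ω
  simp [abs_of_nonneg (h0 n ω)]

theorem measurableSet_dist_le {α : Type*} [MeasurableSpace α] {F G : α → UnitAddCircle}
    (hF : Measurable F) (hG : Measurable G) (c : ℝ) :
    MeasurableSet {a | dist (F a) (G a) ≤ c} :=
  measurableSet_le (hF.dist hG) measurable_const

namespace MemorylessNoise

variable {T : Type*} [AddCommMonoid T] [Preorder T] {Ω : Type*} [mΩ : MeasurableSpace Ω]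
  {P : Measure Ω} (N : MemorylessNoise T P)

theorem future_le : N.future ≤ mΩ := iSup_le N.ℱ.le

/-- A random point which is known at time `t` behaves like a deterministic point with regard to
events of the noise after time `t`. -/
theorem measure_shift_mem_le [IsProbabilityMeasure P] {t : T} {Z : Ω → UnitAddCircle}
    (hZ : Measurable[N.ℱ t] Z) {W : Set (Ω × UnitAddCircle)}
    (hW : MeasurableSet[N.future.prod (inferInstance : MeasurableSpace UnitAddCircle)] W)
    {η : ℝ≥0∞} (hη : ∀ x, P {ω | (ω, x) ∈ W} ≤ η) : P {ω | (N.θ t ω, Z ω) ∈ W} ≤ η := by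
  -- The target carries `N.future`, since it is the preimage of this σ-algebra that is independent
  -- of `ℱ t`.
  have hV : @Measurable _ _ mΩ N.future (N.θ t) :=
    (N.measurePreserving_θ t).measurable.mono le_rfl N.future_le
  refine @measure_prodMk_mem_le_of_indepFun Ω UnitAddCircle Ω mΩ _ N.future P _ (N.θ t) Z hV
    (hZ.mono (N.ℱ.le t) le_rfl) ?_ W hW η fun x => ?_
  · exact (ProbabilityTheory.indep_of_indep_of_le_left (N.indep t) hZ.comap_le).symm
  · have hx : MeasurableSet {ω | (ω, x) ∈ W} :=
      N.future_le _ ((@measurable_prodMk_right _ _ N.future _ x) hW)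
    exact ((N.measurePreserving_θ t).measure_preimage hx.nullMeasurableSet).trans_le (hη x)

end MemorylessNoise

/-! ### Measurability of contraction -/

namespace CircleRDS

variable {T : Type*} [AddCommMonoid T] [LinearOrder T] [TopologicalSpace T]
  {Ω : Type*} [mΩ : MeasurableSpace Ω] {P : Measure Ω} {N : MemorylessNoise T P}
  (φ : CircleRDS N)

theorem measurable_toHomeo (t : T) : Measurable (fun p : Ω × UnitAddCircle => φ.toHomeo t p.1 p.2) :=
  (φ.measurable t).mono (sup_le_sup (MeasurableSpace.comap_mono (N.ℱ.le t)) le_rfl) le_rfl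

theorem measurable_toHomeo_future (t : T) :
    Measurable[N.future.prod (inferInstance : MeasurableSpace UnitAddCircle)]
      (fun p : Ω × UnitAddCircle => φ.toHomeo t p.1 p.2) :=
  (φ.measurable t).mono (sup_le_sup (MeasurableSpace.comap_mono (le_iSup N.ℱ t)) le_rfl) le_rfl

theorem measurable_toHomeo_apply (t : T) (x : UnitAddCircle) :
    Measurable[N.ℱ t] (fun ω => φ.toHomeo t ω x) :=
  (φ.measurable t).comp (@measurable_prodMk_right _ _ (N.ℱ t) _ x)

theorem measurable_toHomeo_apply' (t : T) (x : UnitAddCircle) :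
    Measurable (fun ω => φ.toHomeo t ω x) :=
  (φ.measurable_toHomeo_apply t x).mono (N.ℱ.le t) le_rfl

open TopologicalSpace in
-- Right-continuity reduces to countably many times, density to countably many points. The points
-- are taken relative to the centre, so that the conditions on `i` and `j` do not involve `y` and
-- joint measurability in `(ω, y)` follows.
theorem contracts_ball_iff [IsTimeSet T] {e : T} (he : Tendsto (fun n : ℕ => n • e) atTop atTop)
    {S : Set T} (hS : ∀ t, ∃ u : ℕ → T, Antitone u ∧
      (∀ n, u n ∈ S ∧ t ≤ u n) ∧ Tendsto u atTop (𝓝 t)) {ω : Ω} {y : UnitAddCircle} {δ : ℝ} :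
    φ.Contracts ω (Metric.ball y δ) ↔ ∀ k : ℕ, ∃ n : ℕ, ∀ s ∈ S, n • e ≤ s → ∀ i j,
      denseSeq UnitAddCircle i ∈ Metric.ball 0 δ → denseSeq UnitAddCircle j ∈ Metric.ball 0 δ →
      dist (φ.toHomeo s ω (y + denseSeq UnitAddCircle i))
        (φ.toHomeo s ω (y + denseSeq UnitAddCircle j)) ≤ radius k := by
  have : Nonempty T := ⟨0⟩
  constructor
  · intro h k
    obtain ⟨t, ht⟩ := eventually_atTop.1 (h (radius k) (radius_pos k))
    obtain ⟨n, hn⟩ := (he.eventually_ge_atTop t).exists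
    refine ⟨n, fun s _ hs i j hi hj => ht s (hn.trans hs) _ ?_ _ ?_⟩
    · simpa using hi
    · simpa using hj
  · intro h δ' hδ'
    obtain ⟨k, hk⟩ := (tendsto_radius.eventually (gt_mem_nhds hδ')).exists
    obtain ⟨n, hn⟩ := h k
    filter_upwards [eventually_ge_atTop (n • e)] with t ht
    have hD : ∀ i j, denseSeq UnitAddCircle i ∈ Metric.ball 0 δ →
        denseSeq UnitAddCircle j ∈ Metric.ball 0 δ →
        dist (φ.toHomeo t ω (y + denseSeq UnitAddCircle i))
        (φ.toHomeo t ω (y + denseSeq UnitAddCircle j)) ≤ radius k := by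
      intro i j hi hj
      obtain ⟨u, hu, huS, hut⟩ := hS t
      exact le_of_tendsto'
        ((φ.right_continuous ω u t _ _ hu hut tendsto_const_nhds).dist
          (φ.right_continuous ω u t _ _ hu hut tendsto_const_nhds))
        (fun m => hn (u m) (huS m).1 (ht.trans (huS m).2) i j hi hj)
    have hall : ∀ v ∈ Metric.ball (0 : UnitAddCircle) δ, ∀ w ∈ Metric.ball (0 : UnitAddCircle) δ,
        dist (φ.toHomeo t ω (y + v)) (φ.toHomeo t ω (y + w)) ≤ radius k := by
      intro v hv w hw
      by_contra! hcon
      have hcont : Continuous fun q : UnitAddCircle × UnitAddCircle =>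
          dist (φ.toHomeo t ω (y + q.1)) (φ.toHomeo t ω (y + q.2)) := by fun_prop
      obtain ⟨⟨i, j⟩, hij⟩ := ((denseRange_denseSeq UnitAddCircle).prodMap
        (denseRange_denseSeq UnitAddCircle)).exists_mem_open
        ((Metric.isOpen_ball.prod Metric.isOpen_ball).inter
          (isOpen_lt continuous_const hcont)) ⟨(v, w), ⟨hv, hw⟩, hcon⟩
      exact absurd (hD i j hij.1.1 hij.1.2) (not_le.2 hij.2)
    intro v hv w hw
    have := hall (v - y) (by simpa [dist_eq_norm] using hv) (w - y)
      (by simpa [dist_eq_norm] using hw)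
    rw [add_sub_cancel, add_sub_cancel] at this
    exact this.trans hk.le

theorem measurableSet_contracts_prod [IsTimeSet T] (δ : ℝ) :
    MeasurableSet[N.future.prod (inferInstance : MeasurableSpace UnitAddCircle)]
      {p : Ω × UnitAddCircle | φ.Contracts p.1 (Metric.ball p.2 δ)} := by
  obtain ⟨e, he⟩ := IsTimeSet.exists_tendsto_nsmul (T := T)
  obtain ⟨S, hSc, hS⟩ := IsTimeSet.exists_countable (T := T)
  simp only [φ.contracts_ball_iff he hS]
  simp only [Set.ofPred_forall, Set.ofPred_exists]
  refine MeasurableSet.iInter fun k => MeasurableSet.iUnion fun n =>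
    MeasurableSet.biInter hSc fun s _ => MeasurableSet.iInter fun _ => MeasurableSet.iInter fun i =>
    MeasurableSet.iInter fun j => MeasurableSet.iInter fun _ => MeasurableSet.iInter fun _ => ?_
  have hm : ∀ i, Measurable[N.future.prod (inferInstance : MeasurableSpace UnitAddCircle)]
      (fun p : Ω × UnitAddCircle =>
        φ.toHomeo s p.1 (p.2 + TopologicalSpace.denseSeq UnitAddCircle i)) := by
    intro i
    exact (φ.measurable_toHomeo_future s).comp
      (Measurable.prodMk (f := fun p : Ω × UnitAddCircle => p.1)
        (g := fun p : Ω × UnitAddCircle => p.2 + TopologicalSpace.denseSeq UnitAddCircle i)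
        (@measurable_fst _ _ N.future _)
        ((continuous_add_const _).measurable.comp (@measurable_snd _ _ N.future _)))
  exact @measurableSet_dist_le _ (N.future.prod _) _ _ (hm i) (hm j) _

theorem measurableSet_contracts [IsTimeSet T] (y : UnitAddCircle) (δ : ℝ) :
    MeasurableSet[N.future] {ω | φ.Contracts ω (Metric.ball y δ)} :=
  (@measurable_prodMk_right _ _ N.future _ y) (φ.measurableSet_contracts_prod δ)

/-! ### Almost sure existence and measurability of the crack point -/

variable {φ}

theorem antitone_radius : Antitone radius := fun k l hkl => by
  unfold radius
  gcongr

/-- At each point the failure events decrease to a null set as the radius shrinks. A Lebesgue number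
of the resulting cover gives one radius for all centres. -/
theorem IsEverywhereLocallyStable.exists_forall_measure_le [IsTimeSet T] [IsProbabilityMeasure P]
    (h : φ.IsEverywhereLocallyStable) {η : ℝ≥0∞} (hη : 0 < η) :
    ∃ δ > 0, ∀ y, P {ω | ¬ φ.Contracts ω (Metric.ball y δ)} ≤ η := by
  have hx : ∀ x, ∃ k, P {ω | ¬ φ.Contracts ω (Metric.ball x (radius k))} ≤ η := by
    intro x
    have hlim := tendsto_measure_iInter_atTop (μ := P)
      (s := fun k => {ω | ¬ φ.Contracts ω (Metric.ball x (radius k))})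
      (fun k => (N.future_le _ (φ.measurableSet_contracts x (radius k)).compl).nullMeasurableSet)
      (fun k l hkl ω hω hc => hω (hc.mono (Metric.ball_subset_ball (antitone_radius hkl))))
      ⟨0, measure_ne_top _ _⟩
    have h0 : P (⋂ k, {ω | ¬ φ.Contracts ω (Metric.ball x (radius k))}) = 0 := by
      refine measure_mono_null ?_ (ae_iff.1 (h x))
      intro ω hω
      rw [Set.mem_iInter] at hω
      rintro ⟨U, hU, hxU, hlimU⟩
      obtain ⟨ε, hε, hεU⟩ := Metric.isOpen_iff.1 hU x hxU
      obtain ⟨k, hk⟩ := (tendsto_radius.eventually (gt_mem_nhds hε)).exists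
      exact hω k (contracts_ball_of_tendsto_volume
        ((Metric.ball_subset_ball hk.le).trans hεU) hlimU)
    rw [h0] at hlim
    exact (hlim.eventually (ge_mem_nhds hη)).exists
  choose k hk using hx
  obtain ⟨δ, hδ, hcov⟩ := lebesgue_number_lemma_of_metric
    (isCompact_univ (X := UnitAddCircle)) (c := fun x => Metric.ball x (radius (k x)))
    (fun _ => Metric.isOpen_ball)
    (fun x _ => Set.mem_iUnion.2 ⟨x, Metric.mem_ball_self (radius_pos _)⟩)
  refine ⟨δ, hδ, fun y => ?_⟩
  obtain ⟨x, hx⟩ := hcov y trivial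
  refine (measure_mono ?_).trans (hk x)
  exact fun ω (hω : ¬ _) hc => hω (hc.mono hx)

/-- Uniform local stability around a random point which is known at time `t`. -/
theorem IsEverywhereLocallyStable.exists_forall_measure_shift_le [IsTimeSet T]
    [IsProbabilityMeasure P] (h : φ.IsEverywhereLocallyStable) {η : ℝ≥0∞} (hη : 0 < η) :
    ∃ δ > 0, ∀ (t : T) (Z : Ω → UnitAddCircle), Measurable[N.ℱ t] Z →
      P {ω | ¬ φ.Contracts (N.θ t ω) (Metric.ball (Z ω) δ)} ≤ η := by
  obtain ⟨δ, hδ, hδη⟩ := h.exists_forall_measure_le hη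
  exact ⟨δ, hδ, fun t Z hZ =>
    N.measure_shift_mem_le hZ (φ.measurableSet_contracts_prod δ).compl hδη⟩

theorem IsSynchronising.tendsto_measure_le [IsProbabilityMeasure P] (h : φ.IsSynchronising)
    {e : T} (he : Tendsto (fun n : ℕ => n • e) atTop atTop) (x y : UnitAddCircle) {δ : ℝ}
    (hδ : 0 < δ) :
    Tendsto (fun n : ℕ => P {ω | δ ≤ dist (φ.toHomeo (n • e) ω x) (φ.toHomeo (n • e) ω y)})
      atTop (𝓝 0) := by
  refine tendsto_measure_le_of_tendsto_ae (fun n => (φ.measurable_toHomeo_apply' _ x).dist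
    (φ.measurable_toHomeo_apply' _ y)) (fun _ _ => dist_nonneg) ?_ hδ
  filter_upwards [h x y] with ω hω
  exact hω.comp he

/-- Failure has probability at most `η` for every `η > 0`: one half bounds the event that the
endpoints are not yet close at time `n • e`, the other that the `δ`-ball about an endpoint's image
does not contract afterwards. -/
theorem IsStablySynchronising.ae_contracts_or [IsTimeSet T] [IsProbabilityMeasure P]
    (h : φ.IsStablySynchronising) (c : UnitAddCircle) {ε : ℝ} (hε : 0 < ε) (hε' : ε < 1 / 2) :
    ∀ᵐ ω ∂P, φ.Contracts ω (Metric.ball c ε) ∨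
      φ.Contracts ω (Metric.ball (c + ((1 / 2 : ℝ) : UnitAddCircle)) (1 / 2 - ε)) := by
  obtain ⟨e, he⟩ := IsTimeSet.exists_tendsto_nsmul (T := T)
  rw [ae_iff, ← nonpos_iff_eq_zero]
  refine le_of_forall_gt_imp_ge_of_dense fun η hη => ?_
  obtain ⟨δ, hδ, hδη⟩ := h.2.exists_forall_measure_shift_le (ENNReal.half_pos hη.ne')
  have hδ' : 0 < min δ (1 / 2) := by positivity
  obtain ⟨n, hn⟩ := ((h.1.tendsto_measure_le he (c - (ε : UnitAddCircle))
    (c + (ε : UnitAddCircle)) hδ').eventually (ge_mem_nhds (ENNReal.half_pos hη.ne'))).exists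
  have hn' := hδη (n • e) _ (φ.measurable_toHomeo_apply (n • e) (c + (ε : UnitAddCircle)))
  refine le_trans (le_trans (measure_mono ?_) (measure_union_le _ _))
    ((add_le_add hn hn').trans_eq (ENNReal.add_halves η))
  intro ω hω
  by_contra hcon
  simp only [Set.mem_union, Set.mem_ofPred_eq, not_or, not_le, not_not] at hcon
  refine hω ?_
  have hball := Metric.ball_subset_ball (x := φ.toHomeo (n • e) ω (c + (ε : UnitAddCircle)))
    (min_le_left δ (1 / 2))
  rcases (φ.orientationPreserving (n • e) ω).image_ball_subset_or c (min_le_right δ (1 / 2)) hε hε'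
    hcon.1 with hsub | hsub
  · exact Or.inl (hcon.2.of_image (hsub.trans hball))
  · exact Or.inr (hcon.2.of_image (hsub.trans hball))

theorem IsStablySynchronising.ae_exists_isCrackPoint [IsTimeSet T] [IsProbabilityMeasure P]
    (h : φ.IsStablySynchronising) : ∀ᵐ ω ∂P, ∃ p, φ.IsCrackPoint ω p := by
  have := fun k => ae_all_iff.2 fun i => h.ae_contracts_or
    (TopologicalSpace.denseSeq UnitAddCircle i) (radius_pos k) (radius_lt_half k)
  filter_upwards [ae_all_iff.2 this] with ω hω
  exact exists_isCrackPoint_of_forall_or hω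

variable (φ) in
open Classical in
/-- The crack point of `ω` if there is one, and `0` otherwise. -/
noncomputable def crackPoint (ω : Ω) : UnitAddCircle :=
  if h : ∃ p, φ.IsCrackPoint ω p then h.choose else 0

theorem IsCrackPoint.crackPoint_eq {ω : Ω} {p : UnitAddCircle} (hp : φ.IsCrackPoint ω p) :
    φ.crackPoint ω = p := by
  have h : ∃ p, φ.IsCrackPoint ω p := ⟨p, hp⟩
  rw [crackPoint, dif_pos h]
  exact h.choose_spec.eq hp

variable (φ) in
open TopologicalSpace in
theorem measurable_crackPoint [IsTimeSet T] : Measurable[N.future] φ.crackPoint := by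
  have hE : MeasurableSet[N.future] {ω | ∃ p, φ.IsCrackPoint ω p} := by
    simp only [exists_isCrackPoint_iff, Set.ofPred_forall, Set.ofPred_exists]
    exact MeasurableSet.iInter fun k => MeasurableSet.iUnion fun i =>
      φ.measurableSet_contracts _ _
  refine @measurable_of_isOpen _ _ _ _ _ N.future _ fun U hU => ?_
  -- When the complement of a closed ball contracts, the crack point lies in that ball, so countably
  -- many balls detect membership in `U`. The last term accounts for the default value `0`.
  have hset : φ.crackPoint ⁻¹' U =
      ({ω | ∃ p, φ.IsCrackPoint ω p} ∩ ⋃ (i : ℕ) (k : ℕ)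
        (_ : Metric.closedBall (denseSeq UnitAddCircle i) (radius k) ⊆ U),
        {ω | φ.Contracts ω (Metric.ball (denseSeq UnitAddCircle i + ((1 / 2 : ℝ) : UnitAddCircle))
          (1 / 2 - radius k))}) ∪
      ({ω | ∃ p, φ.IsCrackPoint ω p}ᶜ ∩ {_ω | (0 : UnitAddCircle) ∈ U}) := by
    ext ω
    by_cases hω : ∃ p, φ.IsCrackPoint ω p
    · obtain ⟨p, hp⟩ := hω
      have hω' : ω ∈ {ω | ∃ p, φ.IsCrackPoint ω p} := ⟨p, hp⟩
      rw [Set.mem_preimage, hp.crackPoint_eq]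
      simp only [Set.mem_union, Set.mem_inter_iff, hω', Set.mem_compl_iff, true_and, not_true,
        false_and, or_false, Set.mem_iUnion, Set.mem_ofPred_eq, exists_prop]
      constructor
      · intro hpU
        obtain ⟨η, hη, hηU⟩ := Metric.isOpen_iff.1 hU p hpU
        obtain ⟨k, hk⟩ := (tendsto_radius.eventually
          (gt_mem_nhds (show 0 < η / 2 by positivity))).exists
        obtain ⟨i, hi⟩ := exists_denseSeq_ball p (radius_pos k)
        refine ⟨i, k, fun x hx => hηU ?_, hp.contracts_ball ?_⟩
        · rw [Metric.mem_closedBall] at hx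
          rw [Metric.mem_ball] at hi ⊢
          linarith [dist_triangle_right x p (denseSeq UnitAddCircle i)]
        · rw [UnitAddCircle.closedBall_add_half]
          simpa using hi
      · rintro ⟨i, k, hik, hc⟩
        have := hp.notMem_of_contracts Metric.isOpen_ball hc
        rw [UnitAddCircle.ball_add_half, Set.notMem_compl_iff] at this
        exact hik this
    · have hω' : ω ∉ {ω | ∃ p, φ.IsCrackPoint ω p} := hω
      rw [Set.mem_preimage, crackPoint, dif_neg hω]
      simp [hω']
  rw [hset]
  refine (hE.inter ?_).union (hE.compl.inter (MeasurableSet.const _))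
  exact MeasurableSet.iUnion fun i => MeasurableSet.iUnion fun k => MeasurableSet.iUnion fun _ =>
    φ.measurableSet_contracts _ _

theorem IsStablySynchronising.isRandomFixedPoint_crackPoint [IsTimeSet T] [IsProbabilityMeasure P]
    (h : φ.IsStablySynchronising) : φ.IsRandomFixedPoint φ.crackPoint := by
  refine ⟨φ.measurable_crackPoint.mono N.future_le le_rfl, fun t => ?_⟩
  filter_upwards [h.ae_exists_isCrackPoint] with ω ⟨p, hp⟩
  rw [hp.crackPoint_eq, (hp.map t).crackPoint_eq]

end CircleRDS

/-! ### The attractor as a pullback limit -/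

theorem measurable_limUnder_unitAddCircle {α : Type*} [MeasurableSpace α]
    {f : ℕ → α → UnitAddCircle} (hf : ∀ k, Measurable (f k)) :
    Measurable fun a => limUnder atTop fun k => f k a :=
  (StronglyMeasurable.limUnder fun k => (hf k).stronglyMeasurable).measurable

namespace MemorylessNoise

variable {T : Type*} [AddCommMonoid T] [Preorder T] {Ω : Type*} [mΩ : MeasurableSpace Ω]
  {P : Measure Ω} {N : MemorylessNoise T P}

/-- The shift of an invertible noise as an automorphism of the measurable space `Ω`. -/
noncomputable def IsInvertible.shift (hN : N.IsInvertible) (t : T) : Ω ≃ᵐ Ω := (hN t).choose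

theorem IsInvertible.coe_shift (hN : N.IsInvertible) (t : T) : ⇑(hN.shift t) = N.θ t :=
  (hN t).choose_spec

theorem IsInvertible.symm_θ (hN : N.IsInvertible) (t : T) (ω : Ω) :
    (hN.shift t).symm (N.θ t ω) = ω := by
  rw [← hN.coe_shift, MeasurableEquiv.symm_apply_apply]

/-- Invertibility allows arbitrary sets `A`, with no measurability to check. -/
theorem IsInvertible.measure_preimage_θ (hN : N.IsInvertible) (t : T) (A : Set Ω) :
    P (N.θ t ⁻¹' A) = P A := by
  have h : MeasurePreserving (hN.shift t) P P := by
    rw [hN.coe_shift]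
    exact N.measurePreserving_θ t
  rw [← hN.coe_shift]
  exact h.measure_preimage_equiv A

theorem IsInvertible.past_le (hN : N.IsInvertible) : N.past ≤ mΩ := by
  refine MeasurableSpace.generateFrom_le ?_
  rintro _ ⟨t, E, hE, rfl⟩
  rw [← hN.coe_shift, MeasurableEquiv.measurableSet_image]
  exact N.ℱ.le t _ hE

theorem θ_add_apply (s t : T) (ω : Ω) : N.θ (s + t) ω = N.θ t (N.θ s ω) :=
  congrFun (N.θ_add s t) ω

end MemorylessNoise

namespace CircleRDS

variable {T : Type*} [AddCommMonoid T] [LinearOrder T] [TopologicalSpace T]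
  {Ω : Type*} [mΩ : MeasurableSpace Ω] {P : Measure Ω} {N : MemorylessNoise T P}
  {φ : CircleRDS N}

/-- Two trajectories, one of which starts at an arbitrary point, are close to each other with high
probability, uniformly in the starting point. -/
theorem IsStablySynchronising.exists_forall_measure_dist_le [IsTimeSet T] [IsProbabilityMeasure P]
    (h : φ.IsStablySynchronising) {e : T} (he : Tendsto (fun n : ℕ => n • e) atTop atTop)
    (x : UnitAddCircle) {δ : ℝ} (hδ : 0 < δ) {η : ℝ≥0∞} (hη : 0 < η) :
    ∃ M : ℕ, ∀ n ≥ M, ∀ y,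
      P {ω | δ ≤ dist (φ.toHomeo (n • e) ω x) (φ.toHomeo (n • e) ω y)} ≤ η := by
  by_contra! hcon
  choose n hn y hy using hcon
  have hn' : Tendsto n atTop atTop := tendsto_atTop_mono hn tendsto_id
  -- Bad starting points accumulate at some `z`. Near `z` local stability ties them to the
  -- trajectory of `z`, which synchronises with that of `x`.
  obtain ⟨z, -, ψ, hψ, hz⟩ := isCompact_univ.tendsto_subseq (fun k => Set.mem_univ (y k))
  have hlim := tendsto_measure_le_of_tendsto_ae (P := P)
    (f := fun k ω => dist (φ.toHomeo (n (ψ k) • e) ω x) (φ.toHomeo (n (ψ k) • e) ω (y (ψ k))))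
    (fun k => (φ.measurable_toHomeo_apply' _ x).dist (φ.measurable_toHomeo_apply' _ _))
    (fun _ _ => dist_nonneg) ?_ hδ
  · obtain ⟨k, hk⟩ := (hlim.eventually (gt_mem_nhds hη)).exists
    exact lt_asymm hk (hy (ψ k))
  filter_upwards [h.1 x z, h.2 z] with ω hω ⟨U, hU, hzU, hlimU⟩
  obtain ⟨ε, hε, hεU⟩ := Metric.isOpen_iff.1 hU z hzU
  have hc := contracts_ball_of_tendsto_volume hεU hlimU
  have hτ : Tendsto (fun k => n (ψ k) • e) atTop atTop :=
    he.comp (hn'.comp hψ.tendsto_atTop)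
  rw [Metric.tendsto_nhds]
  intro ρ hρ
  filter_upwards [Metric.tendsto_nhds.1 (hω.comp hτ) (ρ / 2) (by positivity),
    hτ.eventually (hc (ρ / 3) (by positivity)), hz.eventually (Metric.ball_mem_nhds z hε)]
    with k h1 h2 h3
  have h4 := h2 z (Metric.mem_ball_self hε) _ h3
  simp only [Function.comp, Real.dist_0_eq_abs, abs_of_nonneg dist_nonneg] at h1 h4 ⊢
  linarith [dist_triangle (φ.toHomeo (n (ψ k) • e) ω x) (φ.toHomeo (n (ψ k) • e) ω z)
    (φ.toHomeo (n (ψ k) • e) ω (y (ψ k)))]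

variable (φ) in
/-- The position at time `0` of the trajectory which started at `x` at time `-t`. -/
noncomputable def pullback (hN : N.IsInvertible) (x : UnitAddCircle) (t : T) (ω : Ω) :
    UnitAddCircle :=
  φ.toHomeo t ((hN.shift t).symm ω) x

variable (hN : N.IsInvertible) (x : UnitAddCircle)

theorem pullback_θ (t : T) (ω : Ω) : φ.pullback hN x t (N.θ t ω) = φ.toHomeo t ω x := by
  rw [pullback, hN.symm_θ]

theorem pullback_add_θ (s t : T) (ω : Ω) :
    φ.pullback hN x (s + t) (N.θ t ω) = φ.toHomeo t ω (φ.pullback hN x s ω) := by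
  obtain ⟨ω, rfl⟩ : ∃ ω', N.θ s ω' = ω := by
    rw [← hN.coe_shift]
    exact (hN.shift s).surjective ω
  rw [← N.θ_add_apply, pullback_θ, pullback_θ, φ.map_add]

theorem measurable_pullback (t : T) : Measurable[N.past] (φ.pullback hN x t) := by
  intro B hB
  refine MeasurableSpace.measurableSet_generateFrom
    ⟨t, _, φ.measurable_toHomeo_apply t x hB, ?_⟩
  rw [← hN.coe_shift, MeasurableEquiv.image_eq_preimage_symm]
  rfl

theorem measurable_pullback' (t : T) : Measurable (φ.pullback hN x t) :=
  (measurable_pullback hN x t).mono hN.past_le le_rfl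

/-- The earlier trajectory spends time `u` reaching a random point independent of the noise over the
remaining time `n • e`, so the bound uniform in the starting point applies. Uniformity in `u` is the
Cauchy property in probability. -/
theorem IsStablySynchronising.exists_forall_measure_dist_pullback_le [IsTimeSet T]
    [IsProbabilityMeasure P] (h : φ.IsStablySynchronising) {e : T}
    (he : Tendsto (fun n : ℕ => n • e) atTop atTop) {δ : ℝ} (hδ : 0 < δ) {η : ℝ≥0∞} (hη : 0 < η) :
    ∃ M : ℕ, ∀ n ≥ M, ∀ u : T,
      P {ω | δ ≤ dist (φ.pullback hN x (n • e) ω) (φ.pullback hN x (u + n • e) ω)} ≤ η := by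
  obtain ⟨M, hM⟩ := h.exists_forall_measure_dist_le he x hδ hη
  refine ⟨M, fun n hn u => ?_⟩
  have hW : MeasurableSet[N.future.prod (inferInstance : MeasurableSpace UnitAddCircle)]
      {p : Ω × UnitAddCircle | dist (φ.toHomeo (n • e) p.1 x) (φ.toHomeo (n • e) p.1 p.2) < δ}ᶜ := by
    refine MeasurableSet.compl ?_
    have h1 : Measurable[N.future] (fun ω => φ.toHomeo (n • e) ω x) :=
      (φ.measurable_toHomeo_apply (n • e) x).mono (le_iSup N.ℱ _) le_rfl
    have h2 := Measurable.prodMk (h1.comp (@measurable_fst _ _ N.future _))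
      (φ.measurable_toHomeo_future (n • e))
    exact h2 (measurableSet_lt (measurable_fst.dist measurable_snd) measurable_const)
  have hη' := N.measure_shift_mem_le (φ.measurable_toHomeo_apply u x) hW (η := η) fun y => by
    simpa [not_lt] using hM n hn y
  rw [← hN.measure_preimage_θ (u + n • e)]
  refine (measure_mono ?_).trans hη'
  intro ω hω
  simp only [Set.mem_preimage, Set.mem_ofPred_eq, pullback_θ, φ.map_add] at hω
  rw [N.θ_add_apply, pullback_θ] at hω
  simpa using hω

/-- The pullback trajectories converge along a sequence of times. -/
theorem IsStablySynchronising.exists_tendsto_pullback [IsTimeSet T] [IsProbabilityMeasure P]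
    (h : φ.IsStablySynchronising) {e : T} (he : Tendsto (fun n : ℕ => n • e) atTop atTop) :
    ∃ a : Ω → UnitAddCircle, Measurable[N.past] a ∧ ∃ ν : ℕ → ℕ, Tendsto ν atTop atTop ∧
      ∀ᵐ ω ∂P, Tendsto (fun k => φ.pullback hN x (ν k • e) ω) atTop (𝓝 (a ω)) := by
  have hη : ∀ k : ℕ, (0 : ℝ≥0∞) < 2⁻¹ ^ k := fun k => ENNReal.pow_pos (by simp) k
  choose M hM using fun k : ℕ => h.exists_forall_measure_dist_pullback_le hN x he
    (show (0 : ℝ) < (1 / 2) ^ k by positivity) (hη k)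
  -- Partial sums dominate each `M k` and make consecutive times differ by a multiple of `e`; the `+
  -- 1` forces divergence.
  let ν : ℕ → ℕ := fun k => ∑ i ∈ Finset.range (k + 1), (M i + 1)
  have hνM : ∀ k, M k ≤ ν k := fun k =>
    (Nat.le_succ _).trans (Finset.single_le_sum (f := fun i => M i + 1) (fun _ _ => Nat.zero_le _)
      (Finset.self_mem_range_succ k))
  have hν : Tendsto ν atTop atTop := by
    refine tendsto_atTop_mono (fun k => ?_) tendsto_id
    have : ∑ i ∈ Finset.range (k + 1), 1 ≤ ν k := Finset.sum_le_sum fun i _ => by omega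
    simp only [Finset.sum_const, Finset.card_range, smul_eq_mul, mul_one] at this
    simp only [id]
    omega
  have hstep : ∀ k, P {ω | (1 / 2 : ℝ) ^ k ≤ dist (φ.pullback hN x (ν k • e) ω)
      (φ.pullback hN x (ν (k + 1) • e) ω)} ≤ 2⁻¹ ^ k := by
    intro k
    have := hM k (ν k) (hνM k) ((M (k + 1) + 1) • e)
    rwa [← add_nsmul, show M (k + 1) + 1 + ν k = ν (k + 1) by
      rw [add_comm]; exact (Finset.sum_range_succ _ (k + 1)).symm] at this
  have hsum : ∑' k, P {ω | (1 / 2 : ℝ) ^ k ≤ dist (φ.pullback hN x (ν k • e) ω)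
      (φ.pullback hN x (ν (k + 1) • e) ω)} ≠ ⊤ := by
    refine ne_top_of_le_ne_top ?_ (ENNReal.tsum_le_tsum hstep)
    rw [ENNReal.tsum_geometric, ENNReal.one_sub_inv_two, inv_inv]
    exact ENNReal.ofNat_ne_top
  refine ⟨fun ω => limUnder atTop fun k => φ.pullback hN x (ν k • e) ω, ?_, ν, hν, ?_⟩
  · exact @measurable_limUnder_unitAddCircle _ N.past _ fun k => measurable_pullback hN x (ν k • e)
  -- By Borel–Cantelli, almost surely all but finitely many steps are below the geometric bound.
  · filter_upwards [ae_eventually_notMem hsum] with ω hω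
    apply CauchySeq.tendsto_limUnder
    apply cauchySeq_of_summable_dist
    refine Summable.of_norm_bounded_eventually_nat (g := fun k => (1 / 2 : ℝ) ^ k)
      (summable_geometric_of_lt_one (by norm_num) (by norm_num)) ?_
    filter_upwards [hω] with k hk
    rw [Real.norm_of_nonneg dist_nonneg]
    simpa using (not_le.1 hk).le

/-- Pullbacks from `ν k • e` and `t + ν k • e` merge in probability. Seen from `θ t ω` they converge
almost surely to `a (θ t ω)` and `φ(t, ω) (a ω)`, so uniqueness of limits in measure identifies the
two. -/
theorem IsStablySynchronising.isRandomFixedPoint_of_tendsto_pullback [IsTimeSet T]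
    [IsProbabilityMeasure P] (h : φ.IsStablySynchronising) {e : T}
    (he : Tendsto (fun n : ℕ => n • e) atTop atTop) {a : Ω → UnitAddCircle} (ham : Measurable a)
    {ν : ℕ → ℕ} (hν : Tendsto ν atTop atTop)
    (ha : ∀ᵐ ω ∂P, Tendsto (fun k => φ.pullback hN x (ν k • e) ω) atTop (𝓝 (a ω))) :
    φ.IsRandomFixedPoint a := by
  refine ⟨ham, fun t => ?_⟩
  let f : ℕ → Ω → ℝ := fun k ω => dist (φ.pullback hN x (ν k • e) ω)
    (φ.pullback hN x (t + ν k • e) ω)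
  have hf : ∀ k, Measurable (f k) := fun k =>
    (measurable_pullback' hN x _).dist (measurable_pullback' hN x _)
  have h0 : TendstoInMeasure P (fun k => f k ∘ N.θ t) atTop (fun _ => 0) := by
    rw [tendstoInMeasure_iff_dist]
    intro δ hδ
    rw [ENNReal.tendsto_nhds_zero]
    intro η hη
    obtain ⟨M, hM⟩ := h.exists_forall_measure_dist_pullback_le hN x he hδ hη
    filter_upwards [hν.eventually_ge_atTop M] with k hk
    refine le_trans (le_of_eq ?_) ((hN.measure_preimage_θ t _).trans_le (hM (ν k) hk t))
    congr 1
    ext ω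
    simp [f]
  have h1 : TendstoInMeasure P (fun k => f k ∘ N.θ t) atTop
      (fun ω => dist (a (N.θ t ω)) (φ.toHomeo t ω (a ω))) := by
    refine tendstoInMeasure_of_tendsto_ae
      (fun k => ((hf k).comp (N.measurePreserving_θ t).measurable).aestronglyMeasurable) ?_
    filter_upwards [ha, (N.measurePreserving_θ t).quasiMeasurePreserving.ae ha] with ω h1 h2
    refine (h2.dist (((φ.toHomeo t ω).continuous.tendsto _).comp h1)).congr fun k => ?_
    simp only [Function.comp, f]
    rw [add_comm t, pullback_add_θ]
  filter_upwards [tendstoInMeasure_ae_unique h0 h1] with ω hω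
  exact (dist_eq_zero.1 hω.symm).symm

/-- With high probability `a` lies in the `δ`-ball about a pullback point and that ball contracts; a
contracting open set cannot contain the crack point. -/
theorem IsStablySynchronising.ae_ne_crackPoint_of_tendsto_pullback [IsTimeSet T]
    [IsProbabilityMeasure P] (h : φ.IsStablySynchronising) {e : T} {a : Ω → UnitAddCircle}
    (ham : Measurable a) {ν : ℕ → ℕ}
    (ha : ∀ᵐ ω ∂P, Tendsto (fun k => φ.pullback hN x (ν k • e) ω) atTop (𝓝 (a ω))) :
    ∀ᵐ ω ∂P, a ω ≠ φ.crackPoint ω := by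
  rw [ae_iff, ← nonpos_iff_eq_zero]
  refine le_of_forall_gt_imp_ge_of_dense fun η hη => ?_
  obtain ⟨δ, hδ, hδη⟩ := h.2.exists_forall_measure_shift_le (ENNReal.half_pos hη.ne')
  have hlim := tendsto_measure_le_of_tendsto_ae (P := P)
    (f := fun k ω => dist (φ.pullback hN x (ν k • e) ω) (a ω))
    (fun k => (measurable_pullback' hN x _).dist ham) (fun _ _ => dist_nonneg)
    (ha.mono fun ω hω => tendsto_iff_dist_tendsto_zero.1 hω) hδ
  obtain ⟨k, hk⟩ := (hlim.eventually (ge_mem_nhds (ENNReal.half_pos hη.ne'))).exists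
  have hk' : P {ω | ¬ φ.Contracts ω (Metric.ball (φ.pullback hN x (ν k • e) ω) δ)} ≤ η / 2 := by
    rw [← hN.measure_preimage_θ (ν k • e)]
    simpa only [Set.preimage_ofPred_eq, pullback_θ] using
      hδη (ν k • e) _ (φ.measurable_toHomeo_apply (ν k • e) x)
  refine le_trans ?_ ((add_le_add hk hk').trans_eq (ENNReal.add_halves η))
  refine le_trans (measure_mono_ae ?_) (measure_union_le _ _)
  filter_upwards [h.ae_exists_isCrackPoint] with ω ⟨p, hp⟩ hω
  by_contra hcon
  have hcon' : ω ∉ {ω | δ ≤ dist (φ.pullback hN x (ν k • e) ω) (a ω)} ∪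
    {ω | ¬ φ.Contracts ω (Metric.ball (φ.pullback hN x (ν k • e) ω) δ)} := hcon
  simp only [Set.mem_union, Set.mem_ofPred_eq, not_or, not_le, not_not] at hcon'
  have hωa : a ω = φ.crackPoint ω := not_not.1 hω
  refine hp.notMem_of_contracts Metric.isOpen_ball hcon'.2 ?_
  rw [← hp.crackPoint_eq, ← hωa, Metric.mem_ball, dist_comm]
  exact hcon'.1

end CircleRDS

/-! ### Classification of invariant measures -/

theorem graphMeasure_fst {Ω : Type*} [MeasurableSpace Ω] {P : Measure Ω} {q : Ω → UnitAddCircle}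
    (hq : Measurable q) : (graphMeasure P q).fst = P := by
  rw [Measure.fst, graphMeasure, Measure.map_map measurable_fst (measurable_id'.prodMk hq)]
  exact Measure.map_id

theorem graphMeasure_smul {Ω : Type*} [MeasurableSpace Ω] {P : Measure Ω} {q : Ω → UnitAddCircle}
    (c : ℝ≥0∞) : graphMeasure (c • P) q = c • graphMeasure P q :=
  Measure.map_smul _ _ _

theorem eq_graphMeasure_fst {Ω : Type*} [MeasurableSpace Ω] {κ : Measure (Ω × UnitAddCircle)}
    {q : Ω → UnitAddCircle} (hq : Measurable q) (h : ∀ᵐ p ∂κ, p.2 = q p.1) :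
    κ = graphMeasure κ.fst q := by
  rw [Measure.fst, graphMeasure, Measure.map_map (measurable_id'.prodMk hq) measurable_fst]
  conv_lhs => rw [← Measure.map_id (μ := κ)]
  refine Measure.map_congr ?_
  filter_upwards [h] with p hp
  exact Prod.ext rfl hp

namespace MemorylessNoise

variable {T : Type*} [AddCommMonoid T] [Preorder T] {Ω : Type*} [mΩ : MeasurableSpace Ω]
  {P : Measure Ω} {N : MemorylessNoise T P}

/-- Up to a scalar, `P` is the only finite `θ`-invariant measure which is absolutely continuous with
respect to the ergodic measure `P`. -/
theorem IsErgodic.eq_smul [IsProbabilityMeasure P] (hN : N.IsErgodic) {ν : Measure Ω}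
    [IsFiniteMeasure ν] (hν : ν ≪ P) (h : ∀ t, MeasurePreserving (N.θ t) ν ν) :
    ∃ c : ℝ≥0∞, ν = c • P := by
  -- The density is `θ`-invariant, so ergodicity gives its level sets probability `0` or `1` and it
  -- is almost surely constant.
  obtain ⟨c, hc⟩ := exists_eventuallyEq_const_of_forall_separating (l := ae P)
    (f := ν.rnDeriv P) MeasurableSet fun U hU => by
      have hm : MeasurableSet (ν.rnDeriv P ⁻¹' U) := ν.measurable_rnDeriv P hU
      rcases hN (ν.rnDeriv P ⁻¹' U) hm fun t => by
        rw [← Set.preimage_comp]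
        exact ((h t).rnDeriv_comp_aeEq (N.measurePreserving_θ t)).preimage U with h0 | h1
      · exact Or.inr (measure_eq_zero_iff_ae_notMem.1 h0)
      · exact Or.inl ((prob_compl_eq_zero_iff hm).2 h1)
  refine ⟨c, ?_⟩
  rw [← Measure.withDensity_rnDeriv_eq ν P hν, withDensity_congr_ae hc]
  exact withDensity_const c

end MemorylessNoise

namespace CircleRDS

variable {T : Type*} [AddCommMonoid T] [LinearOrder T] [TopologicalSpace T]
  {Ω : Type*} [mΩ : MeasurableSpace Ω] {P : Measure Ω} {N : MemorylessNoise T P}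
  {φ : CircleRDS N}

variable (φ) in
theorem measurable_skewProduct (t : T) : Measurable (φ.skewProduct t) :=
  ((N.measurePreserving_θ t).measurable.comp measurable_fst).prodMk (φ.measurable_toHomeo t)

theorem IsRandomFixedPoint.measurePreserving_graphMeasure {q : Ω → UnitAddCircle}
    (hq : φ.IsRandomFixedPoint q) (t : T) :
    MeasurePreserving (φ.skewProduct t) (graphMeasure P q) (graphMeasure P q) := by
  refine ⟨φ.measurable_skewProduct t, ?_⟩
  have hgm : Measurable fun ω => (ω, q ω) := measurable_id'.prodMk hq.1
  conv_rhs => rw [graphMeasure, ← (N.measurePreserving_θ t).map_eq]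
  rw [graphMeasure, Measure.map_map (φ.measurable_skewProduct t) hgm,
    Measure.map_map hgm (N.measurePreserving_θ t).measurable]
  refine Measure.map_congr ?_
  filter_upwards [hq.2 t] with ω hω
  exact Prod.ext rfl hω

theorem isInvariantMeasure_of_isRandomFixedPoint {a r : Ω → UnitAddCircle}
    (ha : φ.IsRandomFixedPoint a) (hr : φ.IsRandomFixedPoint r) {c : ℝ≥0∞} (hc : c ≤ 1) :
    φ.IsInvariantMeasure (c • graphMeasure P r + (1 - c) • graphMeasure P a) := by
  constructor
  · rw [Measure.fst, Measure.map_add _ _ measurable_fst, Measure.map_smul, Measure.map_smul]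
    change c • (graphMeasure P r).fst + (1 - c) • (graphMeasure P a).fst = P
    rw [graphMeasure_fst hr.1, graphMeasure_fst ha.1, ← add_smul, add_tsub_cancel_of_le hc,
      one_smul]
  · intro t
    refine ⟨φ.measurable_skewProduct t, ?_⟩
    rw [Measure.map_add _ _ (φ.measurable_skewProduct t), Measure.map_smul, Measure.map_smul,
      (hr.measurePreserving_graphMeasure t).map_eq, (ha.measurePreserving_graphMeasure t).map_eq]

theorem measurePreserving_fst_of_skewProduct {κ : Measure (Ω × UnitAddCircle)} {t : T}
    (h : MeasurePreserving (φ.skewProduct t) κ κ) : MeasurePreserving (N.θ t) κ.fst κ.fst := by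
  refine ⟨(N.measurePreserving_θ t).measurable, ?_⟩
  conv_rhs => rw [Measure.fst, ← h.map_eq]
  rw [Measure.fst, Measure.map_map (N.measurePreserving_θ t).measurable measurable_fst,
    Measure.map_map measurable_fst (φ.measurable_skewProduct t)]
  rfl

/-- A finite invariant measure all of whose trajectories converge to that of a random fixed point
is concentrated on that random fixed point. -/
theorem IsRandomFixedPoint.ae_eq_of_tendsto {a : Ω → UnitAddCircle} (ha : φ.IsRandomFixedPoint a)
    {κ : Measure (Ω × UnitAddCircle)} [IsFiniteMeasure κ] (hκP : κ.fst ≪ P)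
    (hκ : ∀ t, MeasurePreserving (φ.skewProduct t) κ κ) {e : T}
    (he : Tendsto (fun n : ℕ => n • e) atTop atTop)
    (hlim : ∀ᵐ p ∂κ, Tendsto (fun t => dist (φ.toHomeo t p.1 p.2) (φ.toHomeo t p.1 (a p.1)))
      atTop (𝓝 0)) : ∀ᵐ p ∂κ, p.2 = a p.1 := by
  have hm : Measurable fun p : Ω × UnitAddCircle => dist p.2 (a p.1) :=
    measurable_snd.dist (ha.1.comp measurable_fst)
  have hfix : ∀ᵐ p ∂κ, ∀ n : ℕ, φ.toHomeo (n • e) p.1 (a p.1) = a (N.θ (n • e) p.1) :=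
    ae_of_ae_map measurable_fst.aemeasurable (hκP.ae_le (ae_all_iff.2 fun n => ha.2 (n • e)))
  -- By invariance this measure equals that of the preimage at each time `n • e`, which tends to
  -- `0`.
  have hzero : ∀ δ : ℝ, 0 < δ → κ {p | δ ≤ dist p.2 (a p.1)} = 0 := by
    intro δ hδ
    have h := tendsto_measure_le_of_tendsto_ae (P := κ)
      (f := fun n => (fun p => dist p.2 (a p.1)) ∘ φ.skewProduct (n • e))
      (fun n => hm.comp (φ.measurable_skewProduct _)) (fun _ _ => dist_nonneg) ?_ hδ
    · refine tendsto_nhds_unique (tendsto_const_nhds.congr fun n => ?_) h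
      exact ((hκ (n • e)).measure_preimage
        (measurableSet_le measurable_const hm).nullMeasurableSet).symm
    · filter_upwards [hlim, hfix] with p h1 h2
      refine (h1.comp he).congr fun n => ?_
      simp [skewProduct, h2]
  have hall : ∀ᵐ p ∂κ, ∀ k, dist p.2 (a p.1) < radius k := ae_all_iff.2 fun k => by
    simpa only [ae_iff, not_lt] using hzero _ (radius_pos k)
  filter_upwards [hall] with p hp
  exact dist_le_zero.1 (ge_of_tendsto' tendsto_radius fun k => (hp k).le)

theorem IsInvariantMeasure.eq_graphMeasure_add [IsTimeSet T] [IsProbabilityMeasure P]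
    (hN : N.IsErgodic) {a r : Ω → UnitAddCircle} (ha : φ.IsRandomFixedPoint a)
    (hr : φ.IsRandomFixedPoint r)
    (hlim : ∀ᵐ ω ∂P, ∀ x, x ≠ r ω →
      Tendsto (fun t => dist (φ.toHomeo t ω x) (φ.toHomeo t ω (a ω))) atTop (𝓝 0))
    {μ : Measure (Ω × UnitAddCircle)} (hμ : φ.IsInvariantMeasure μ) :
    ∃ c : ℝ≥0∞, c ≤ 1 ∧ μ = c • graphMeasure P r + (1 - c) • graphMeasure P a := by
  obtain ⟨e, he⟩ := IsTimeSet.exists_tendsto_nsmul (T := T)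
  have hμ1 : IsProbabilityMeasure μ := ⟨by rw [← Measure.fst_univ, hμ.1, measure_univ]⟩
  have hfst : ∀ {p : Ω → Prop}, (∀ᵐ ω ∂P, p ω) → ∀ᵐ q ∂μ, p q.1 := fun hp =>
    ae_of_ae_map measurable_fst.aemeasurable (by rw [← hμ.1] at hp; exact hp)
  let R : Set (Ω × UnitAddCircle) := {p | p.2 = r p.1}
  have hR : MeasurableSet R := measurableSet_eq_fun measurable_snd (hr.1.comp measurable_fst)
  -- Injectivity of `φ(t, ω)` gives both inclusions: no point off the graph of `r` can enter it.
  have hRinv : ∀ t, φ.skewProduct t ⁻¹' R =ᵐ[μ] R := by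
    intro t
    filter_upwards [hfst (hr.2 t)] with p hp
    refine propext ?_
    change φ.toHomeo t p.1 p.2 = r (N.θ t p.1) ↔ p.2 = r p.1
    rw [← hp]
    exact (φ.toHomeo t p.1).injective.eq_iff
  have hrestr : ∀ t, MeasurePreserving (φ.skewProduct t) (μ.restrict R) (μ.restrict R) := by
    intro t
    have := (hμ.2 t).restrict_preimage hR
    rwa [Measure.restrict_congr_set (hRinv t)] at this
  have hrestr' : ∀ t, MeasurePreserving (φ.skewProduct t) (μ.restrict Rᶜ) (μ.restrict Rᶜ) := by
    intro t
    have := (hμ.2 t).restrict_preimage hR.compl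
    rwa [Set.preimage_compl, Measure.restrict_congr_set (hRinv t).compl] at this
  have hac : ∀ A : Set (Ω × UnitAddCircle), (μ.restrict A).fst ≪ P := fun A => by
    conv_rhs => rw [← hμ.1]
    exact Measure.AbsolutelyContinuous.map Measure.restrict_le_self.absolutelyContinuous
      measurable_fst
  obtain ⟨c, hc⟩ := hN.eq_smul (hac R) fun t => measurePreserving_fst_of_skewProduct (hrestr t)
  obtain ⟨c', hc'⟩ := hN.eq_smul (hac Rᶜ) fun t => measurePreserving_fst_of_skewProduct (hrestr' t)
  have h1 : μ.restrict R = c • graphMeasure P r := by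
    rw [← graphMeasure_smul, ← hc]
    exact eq_graphMeasure_fst hr.1 (ae_restrict_mem hR)
  have h2 : μ.restrict Rᶜ = c' • graphMeasure P a := by
    rw [← graphMeasure_smul, ← hc']
    refine eq_graphMeasure_fst ha.1 (ha.ae_eq_of_tendsto (hac Rᶜ) hrestr' he ?_)
    filter_upwards [ae_restrict_mem hR.compl, ae_restrict_of_ae (hfst hlim)] with p hp hq
    exact hq _ hp
  have hcc : c + c' = 1 := by
    have h3 : c = μ R := by
      have := congrArg (fun ν : Measure Ω => ν Set.univ) hc
      simpa [Measure.fst_univ] using this.symm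
    have h4 : c' = μ Rᶜ := by
      have := congrArg (fun ν : Measure Ω => ν Set.univ) hc'
      simpa [Measure.fst_univ] using this.symm
    rw [h3, h4, measure_add_measure_compl hR, measure_univ]
  have hc1 : c ≤ 1 := hcc ▸ le_self_add
  refine ⟨c, hc1, ?_⟩
  rw [← hcc, ENNReal.add_sub_cancel_left (ne_top_of_le_ne_top ENNReal.one_ne_top hc1), ← h1, ← h2,
    Measure.restrict_add_restrict_compl hR]

theorem IsStablySynchronising.isSimple [IsTimeSet T] [IsProbabilityMeasure P]
    (h : φ.IsStablySynchronising) (hinv : N.IsInvertible) (herg : N.IsErgodic) : φ.IsSimple := by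
  obtain ⟨e, he⟩ := IsTimeSet.exists_tendsto_nsmul (T := T)
  -- The starting point `0` of the pullback is an arbitrary choice.
  obtain ⟨a, ham, ν, hν, ha⟩ := h.exists_tendsto_pullback hinv 0 he
  have ham' : Measurable a := ham.mono hinv.past_le le_rfl
  have hfix := h.isRandomFixedPoint_of_tendsto_pullback hinv 0 he ham' hν ha
  have hne := h.ae_ne_crackPoint_of_tendsto_pullback hinv 0 ham' ha
  have hlim : ∀ᵐ ω ∂P, ∀ x, x ≠ φ.crackPoint ω →
      Tendsto (fun t => dist (φ.toHomeo t ω x) (φ.toHomeo t ω (a ω))) atTop (𝓝 0) := by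
    filter_upwards [h.ae_exists_isCrackPoint, hne] with ω ⟨p, hp⟩ hω x hx
    rw [hp.crackPoint_eq] at hω hx
    exact hp.tendsto_dist hx hω
  exact ⟨a, φ.crackPoint,
    { ae_contractive := h.ae_exists_isCrackPoint
      repeller_eq := fun ω p hp => hp.crackPoint_eq
      repeller_fixed := h.isRandomFixedPoint_crackPoint
      repeller_future := φ.measurable_crackPoint
      attractor_fixed := hfix
      attractor_past := ham
      ae_ne := hne
      attracts := hlim
      invariant_iff := fun μ =>
        ⟨fun hμ => hμ.eq_graphMeasure_add herg hfix h.isRandomFixedPoint_crackPoint hlim, by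
          rintro ⟨c, hc, rfl⟩
          exact isInvariantMeasure_of_isRandomFixedPoint hfix h.isRandomFixedPoint_crackPoint hc⟩ }⟩

end CircleRDS

theorem theorem5p13 {Ω : Type*} [MeasurableSpace Ω] (P : Measure Ω) [IsProbabilityMeasure P] :
    (∀ (N : MemorylessNoise ℕ P) (φ : CircleRDS N), N.IsInvertible → N.IsErgodic →
      φ.IsStablySynchronising → φ.IsSimple) ∧
    (∀ (N : MemorylessNoise ℝ≥0 P) (φ : CircleRDS N), N.IsInvertible → N.IsErgodic →
      φ.IsStablySynchronising → φ.IsSimple) :=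
  ⟨fun _ _ hinv herg h => h.isSimple hinv herg, fun _ _ hinv herg h => h.isSimple hinv herg⟩
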